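/- Throughout, $M'$ denotes the commutant of a von Neumann algebra $M$ on a complex Hilbert space $\mathcal H$. A vector $\Psi\in\mathcal H$ is *cyclic* for $M$ if $M\Psi$ is dense in $\mathcal H$, and *separating* for $M$ if $\mathcal O\in M$, $\mathcal O\Psi=0$ imply $\mathcal O=0$. For $\Psi,\Phi\in\mathcal H$ with $\Psi$ cyclic and separating for $M$, the *relative Tomita operator* $S_{\Psi|\Phi}$ is the closed densely defined antilinear operator with $S_{\Psi|\Phi}x=y$ whenever there is a sequence $\mathcal O_n\in M$ with $\mathcal O_n\Psi\to x$ and $\mathcal O_n^\dagger\Phi\to y$; the *relative modular operator* is $\Delta_{\Psi|\Phi}=S_{\Psi|\Phi}^\dagger S_{\Psi|\Phi}$; and the (Araki) *relative entropy* is $$\mathcal S_{\Psi|\Phi}(M)=-\langle\Psi,\log\Delta_{\Psi|\Phi}\,\Psi\rangle=-\int_{[0,\infty)}\log\lambda\;d\langle\Psi,P_\lambda\Psi\rangle\in(-\infty,+\infty],$$ where $P$ is the projection-valued measure of $\Delta_{\Psi|\Phi}$ and $\log 0=-\infty$. **Theorem 1.** Let $u:\mathcal H_{code}\to\mathcal H_{phys}$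 be a (linear, not necessarily surjective) isometry between complex Hilbert spaces, and let $M_{code}$, $M_{phys}$ be von Neumann algebras on $\mathcal H_{code}$, $\mathcal H_{phys}$. Suppose that the set of cyclic and separating vectors for $M_{code}$ is dense in $\mathcal H_{code}$, and that $u\Psi$ is cyclic and separating for $M_{phys}$ whenever $\Psi\in\mathcal H_{code}$ is cyclic and separating for $M_{code}$. Then the following two statements are equivalent. 1. (Bulk reconstruction) For all $\mathcal O\in M_{code}$ and $\mathcal O'\in M_{code}'$ there are $\tilde{\mathcal O}\in M_{phys}$ and $\tilde{\mathcal O}'\in M_{phys}'$ such that for all $\Theta\in\mathcal H_{code}$ $$u\mathcal O\Theta=\tilde{\mathcal O}u\Theta,\quad u\mathcal O'\Theta=\tilde{\mathcal O}'u\Theta,\quad u\mathcal O^\dagger\Theta=\tilde{\mathcal O}^\dagger u\Theta,\quad u\mathcal O'^\dagger\Theta=\tilde{\mathcal O}'^\dagger u\Theta.$$ 2. (Boundary relative entropy equals bulk relative entropy) For all $\Psi,\Phi\in\mathcal H_{code}$ with $\Psi$ cyclic and separating for $M_{code}$, $$\mathcal S_{\Psi|\Phi}(M_{code})=\mathcal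 S_{u\Psi|u\Phi}(M_{phys})\quad\text{and}\quad\mathcal S_{\Psi|\Phi}(M_{code}')=\mathcal S_{u\Psi|u\Phi}(M_{phys}').$$ Moreover, if statement 2 holds, then the reconstruction is given by an explicit formula: for every $\mathcal O\in M_{code}$ there is $\tilde{\mathcal O}\in M_{phys}$ with $u\mathcal O=\tilde{\mathcal O}u$ and $u\mathcal O^\dagger=\tilde{\mathcal O}^\dagger u$ such that, for every vector $\Phi\in\mathcal H_{code}$ that is cyclic and separating for $M_{code}$, $\tilde{\mathcal O}$ is the unique bounded operator on $\mathcal H_{phys}$ with $$\tilde{\mathcal O}\,\mathcal P'u\Phi=\mathcal P'u\,\mathcal O\Phi\qquad\text{for all }\mathcal P'\in M_{phys}'$$ (in particular $\tilde{\mathcal O}$ does not depend on $\Phi$); and the same holds with $(M_{code}',M_{phys}')$ in place of $(M_{code},M_{phys})$. -/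

import Mathlib

open scoped ENNReal InnerProductSpace
open Filter Topology MeasureTheory

noncomputable section

universe v

/-! ### Cyclic and separating vectors -/

namespace VonNeumannAlgebra

variable {H : Type v} [NormedAddCommGroup H] [InnerProductSpace ℂ H] [CompleteSpace H]

/-- `Ψ` is cyclic for `M`: the vectors `O Ψ` with `O ∈ M` are dense in `H`. -/
def IsCyclicVector (M : VonNeumannAlgebra H) (Ψ : H) : Prop :=
  Dense {x : H | ∃ O ∈ M, O Ψ = x}

/-- `Ψ` is separating for `M`: zero is the only operator in `M` that annihilates `Ψ`. -/
def IsSeparatingVector (M : VonNeumannAlgebra H) (Ψ : H) : Prop :=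
  ∀ O ∈ M, O Ψ = 0 → O = 0

/-- `Ψ` is cyclic and separating for `M`. -/
def IsCyclicSeparating (M : VonNeumannAlgebra H) (Ψ : H) : Prop :=
  M.IsCyclicVector Ψ ∧ M.IsSeparatingVector Ψ

end VonNeumannAlgebra

/-! ### Unbounded antilinear operators -/

section Antilinear

variable {H : Type v} [NormedAddCommGroup H] [InnerProductSpace ℂ H] [CompleteSpace H]

open scoped Classical in
/-- The (in general unbounded) antilinear operator `S` with `S x = y` whenever `r x y`, defined on
all `x` for which such a `y` exists. If the antilinear relation `r` is not single-valued, the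
values are set to `0`. -/
def antilinearOfRel (r : H → H → Prop) (h0 : r 0 0)
    (hadd : ∀ x y x' y', r x y → r x' y' → r (x + x') (y + y'))
    (hsmul : ∀ (c : ℂ) x y, r x y → r (c • x) (starRingEnd ℂ c • y)) :
    LinearPMap (starRingEnd ℂ) H H where
  domain :=
    { carrier := {x | ∃ y, r x y}
      zero_mem' := ⟨0, h0⟩
      add_mem' := by
        rintro x x' ⟨y, hy⟩ ⟨y', hy'⟩
        exact ⟨y + y', hadd _ _ _ _ hy hy'⟩
      smul_mem' := by
        rintro c x ⟨y, hy⟩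
        exact ⟨_, hsmul c _ _ hy⟩ }
  toFun :=
    if h : ∀ x y y', r x y → r x y' → y = y' then
      { toFun := fun x => x.2.choose
        map_add' := fun a b => h _ _ _ (a + b).2.choose_spec
          (hadd _ _ _ _ a.2.choose_spec b.2.choose_spec)
        map_smul' := fun c a => h _ _ _ (c • a).2.choose_spec
          (hsmul c _ _ a.2.choose_spec) }
    else 0

/-- The adjoint of a densely defined antilinear operator `S`: `S† φ = η` means
`⟪φ, S ψ⟫ = ⟪ψ, η⟫` for all `ψ` in the domain of `S`. -/
def antilinearAdjoint (S : LinearPMap (starRingEnd ℂ) H H) : LinearPMap (starRingEnd ℂ) H H :=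
  antilinearOfRel (fun φ η => ∀ ψ : S.domain, ⟪φ, S ψ⟫_ℂ = ⟪(ψ : H), η⟫_ℂ)
    (fun ψ => by simp)
    (fun x y x' y' h h' ψ => by rw [inner_add_left, inner_add_right, h, h'])
    (fun c x y h ψ => by rw [inner_smul_left, inner_smul_right, h])

/-- The composite `T S` of two antilinear operators, a linear operator with domain
`{x ∈ D(S) | S x ∈ D(T)}`. -/
def antilinearComp (T S : LinearPMap (starRingEnd ℂ) H H) : H →ₗ.[ℂ] H where
  domain :=
    { carrier := {x | ∃ hx : x ∈ S.domain, S ⟨x, hx⟩ ∈ T.domain}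
      zero_mem' := ⟨S.domain.zero_mem, by
        have h : S ⟨0, S.domain.zero_mem⟩ = 0 := S.map_zero
        rw [h]; exact T.domain.zero_mem⟩
      add_mem' := by
        rintro x y ⟨hx, hx'⟩ ⟨hy, hy'⟩
        refine ⟨S.domain.add_mem hx hy, ?_⟩
        have h : S ⟨x + y, S.domain.add_mem hx hy⟩ = S ⟨x, hx⟩ + S ⟨y, hy⟩ :=
          S.map_add ⟨x, hx⟩ ⟨y, hy⟩
        rw [h]; exact T.domain.add_mem hx' hy'
      smul_mem' := by
        rintro c x ⟨hx, hx'⟩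
        refine ⟨S.domain.smul_mem c hx, ?_⟩
        have h : S ⟨c • x, S.domain.smul_mem c hx⟩ = starRingEnd ℂ c • S ⟨x, hx⟩ :=
          S.map_smulₛₗ c ⟨x, hx⟩
        rw [h]; exact T.domain.smul_mem _ hx' }
  toFun :=
    { toFun := fun x => T ⟨S ⟨x, x.2.choose⟩, x.2.choose_spec⟩
      map_add' := by
        rintro ⟨x, hx, hx'⟩ ⟨y, hy, hy'⟩
        have h := T.map_add ⟨S ⟨x, hx⟩, hx'⟩ ⟨S ⟨y, hy⟩, hy'⟩
        rw [← h]
        congr 1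
        exact Subtype.ext (S.map_add ⟨x, hx⟩ ⟨y, hy⟩)
      map_smul' := by
        rintro c ⟨x, hx, hx'⟩
        have h := T.map_smulₛₗ (starRingEnd ℂ c) ⟨S ⟨x, hx⟩, hx'⟩
        rw [Complex.conj_conj] at h
        simp only [RingHom.id_apply]
        rw [← h]
        congr 1
        exact Subtype.ext (S.map_smulₛₗ c ⟨x, hx⟩) }

end Antilinear

/-! ### Projection-valued measures and the logarithm of a self-adjoint operator -/

/-- A projection-valued measure on the Borel sets of `ℝ`. -/
structure ProjectionValuedMeasure (H : Type v) [NormedAddCommGroup H] [InnerProductSpace ℂ H]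
    [CompleteSpace H] where
  /-- The projection assigned to a Borel set (values on other sets are irrelevant). -/
  proj : Set ℝ → H →L[ℂ] H
  isStarProjection : ∀ s, MeasurableSet s → IsStarProjection (proj s)
  proj_empty : proj ∅ = 0
  proj_univ : proj Set.univ = 1
  proj_inter : ∀ s t, MeasurableSet s → MeasurableSet t → proj s * proj t = proj (s ∩ t)
  hasSum_proj : ∀ s : ℕ → Set ℝ, (∀ n, MeasurableSet (s n)) →
    Pairwise (Function.onFun Disjoint s) → ∀ ψ : H, HasSum (fun n => proj (s n) ψ) (proj (⋃ n, s n) ψ)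

section Spectral

variable {H : Type v} [NormedAddCommGroup H] [InnerProductSpace ℂ H] [CompleteSpace H]

theorem ProjectionValuedMeasure.re_inner_nonneg (P : ProjectionValuedMeasure H) (ψ : H)
    {s : Set ℝ} (hs : MeasurableSet s) : 0 ≤ (⟪ψ, P.proj s ψ⟫_ℂ).re := by
  have hp := P.isStarProjection s hs
  have h : ⟪ψ, P.proj s ψ⟫_ℂ = ⟪P.proj s ψ, P.proj s ψ⟫_ℂ := by
    conv_lhs => rw [← hp.isIdempotentElem.eq]
    rw [mul_apply_eq_comp, ← ContinuousLinearMap.adjoint_inner_left,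
      ← ContinuousLinearMap.star_eq_adjoint, hp.isSelfAdjoint.star_eq]
  rw [h]
  exact inner_self_nonneg (𝕜 := ℂ)

/-- The finite Borel measure `s ↦ ⟪ψ, P(s) ψ⟫` on `ℝ`. -/
def ProjectionValuedMeasure.measure (P : ProjectionValuedMeasure H) (ψ : H) : Measure ℝ :=
  Measure.ofMeasurable (fun s _ => ENNReal.ofReal (⟪ψ, P.proj s ψ⟫_ℂ).re)
    (by simp [P.proj_empty])
    (by
      intro s hs hd
      have h := P.hasSum_proj s hs hd ψ
      have h2 : HasSum (fun n => (⟪ψ, P.proj (s n) ψ⟫_ℂ).re) (⟪ψ, P.proj (⋃ n, s n) ψ⟫_ℂ).re :=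
        Complex.hasSum_re (h.mapL (innerSL ℂ ψ))
      rw [← h2.tsum_eq, ENNReal.ofReal_tsum_of_nonneg
        (fun n => P.re_inner_nonneg ψ (hs n)) h2.summable])

/-- `A = ∫ t dP(t)`: the domain of `A` consists of the `ψ` with `∫ t² d⟪ψ, P(t) ψ⟫ < ∞`, and
`⟪ψ, A ψ⟫ = ∫ t d⟪ψ, P(t) ψ⟫` on it. By polarization the second condition determines `A` on its
domain. -/
def ProjectionValuedMeasure.IsSpectralMeasureOf (P : ProjectionValuedMeasure H)
    (A : H →ₗ.[ℂ] H) : Prop :=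
  (∀ ψ : H, ψ ∈ A.domain ↔ Integrable (fun t : ℝ => t ^ 2) (P.measure ψ)) ∧
    ∀ ψ : A.domain, ⟪(ψ : H), A ψ⟫_ℂ = ((∫ t, t ∂(P.measure (ψ : H)) : ℝ) : ℂ)

/-- The logarithm of a nonnegative real number, with `log 0 = -∞`. -/
def elog (t : ℝ) : EReal := ENNReal.log (ENNReal.ofReal t)

/-- The integral `∫_{[0,∞)} log t dμ(t)` as an extended real number (positive part minus negative
part). It is used below only where the positive part is finite. -/
def logIntegral (μ : Measure ℝ) : EReal :=
  ((∫⁻ t in Set.Ici (0 : ℝ), (elog t).toENNReal ∂μ : ℝ≥0∞) : EReal)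
    - ((∫⁻ t in Set.Ici (0 : ℝ), (-elog t).toENNReal ∂μ : ℝ≥0∞) : EReal)

open scoped Classical in
/-- `⟪ψ, (log A) ψ⟫ = ∫_{[0,∞)} log t d⟪ψ, P(t) ψ⟫` for a positive self-adjoint operator `A`, where
`P` is the projection-valued measure of `A` (which exists and is unique for every self-adjoint
operator, by the spectral theorem). -/
def logExpectation (A : H →ₗ.[ℂ] H) (ψ : H) : EReal :=
  if h : ∃ P : ProjectionValuedMeasure H, P.IsSpectralMeasureOf A then
    logIntegral (h.choose.measure ψ)
  else 0

end Spectral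

/-! ### The relative modular operator and the relative entropy -/

namespace VonNeumannAlgebra

variable {H : Type v} [NormedAddCommGroup H] [InnerProductSpace ℂ H] [CompleteSpace H]

/-- There is a sequence `O n` in `M` with `O n Ψ → x` and `(O n)† Φ → y`. -/
def IsTomitaPair (M : VonNeumannAlgebra H) (Ψ Φ x y : H) : Prop :=
  ∃ O : ℕ → H →L[ℂ] H, (∀ n, O n ∈ M) ∧
    Tendsto (fun n => O n Ψ) atTop (𝓝 x) ∧ Tendsto (fun n => (star (O n)) Φ) atTop (𝓝 y)

/-- The relative Tomita operator `S_{Ψ|Φ}`: the antilinear operator with `S x = y` whenever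
`x = lim O n Ψ` and `y = lim (O n)† Φ` for a sequence `O n` in `M`. -/
def relTomita (M : VonNeumannAlgebra H) (Ψ Φ : H) : LinearPMap (starRingEnd ℂ) H H :=
  antilinearOfRel (M.IsTomitaPair Ψ Φ)
    ⟨fun _ => 0, fun _ => zero_mem M, by simp, by simp⟩
    (by
      rintro x y x' y' ⟨O, hO, h1, h2⟩ ⟨O', hO', h1', h2'⟩
      refine ⟨fun n => O n + O' n, fun n => add_mem (hO n) (hO' n), ?_, ?_⟩
      · simpa using h1.add h1'
      · simpa using h2.add h2')
    (by
      rintro c x y ⟨O, hO, h1, h2⟩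
      refine ⟨fun n => c • O n, fun n => M.toStarSubalgebra.smul_mem (hO n) c, ?_, ?_⟩
      · simpa using h1.const_smul c
      · simpa using h2.const_smul (starRingEnd ℂ c))

/-- The relative modular operator `Δ_{Ψ|Φ} = S_{Ψ|Φ}† S_{Ψ|Φ}`. -/
def relModular (M : VonNeumannAlgebra H) (Ψ Φ : H) : H →ₗ.[ℂ] H :=
  antilinearComp (antilinearAdjoint (M.relTomita Ψ Φ)) (M.relTomita Ψ Φ)

/-- The relative entropy `𝒮_{Ψ|Φ}(M) = -⟪Ψ, (log Δ_{Ψ|Φ}) Ψ⟫`, for `Ψ` cyclic and separating. Its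
values lie in `(-∞, +∞]`. -/
def relEntropy (M : VonNeumannAlgebra H) (Ψ Φ : H) : EReal :=
  -logExpectation (M.relModular Ψ Φ) Ψ

end VonNeumannAlgebra

/-! ### Reconstruction -/

section Codes

variable {Hcode : Type*} [NormedAddCommGroup Hcode] [InnerProductSpace ℂ Hcode]
  [CompleteSpace Hcode] {Hphys : Type*} [NormedAddCommGroup Hphys] [InnerProductSpace ℂ Hphys]
  [CompleteSpace Hphys]

/-- Bulk reconstruction, for the algebra and its commutant. -/
def BulkReconstruction (u : Hcode →ₗᵢ[ℂ] Hphys) (Mcode : VonNeumannAlgebra Hcode)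
    (Mphys : VonNeumannAlgebra Hphys) : Prop :=
  ∀ O ∈ Mcode, ∀ O' ∈ Mcode.commutant, ∃ R ∈ Mphys, ∃ R' ∈ Mphys.commutant, ∀ Θ : Hcode,
    u (O Θ) = R (u Θ) ∧ u (O' Θ) = R' (u Θ) ∧
      u ((star O) Θ) = (star R) (u Θ) ∧ u ((star O') Θ) = (star R') (u Θ)

/-- Equality of boundary and bulk relative entropies, for the algebra and its commutant. -/
def RelativeEntropiesAgree (u : Hcode →ₗᵢ[ℂ] Hphys) (Mcode : VonNeumannAlgebra Hcode)
    (Mphys : VonNeumannAlgebra Hphys) : Prop :=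
  ∀ Ψ Φ : Hcode, Mcode.IsCyclicSeparating Ψ →
    Mcode.relEntropy Ψ Φ = Mphys.relEntropy (u Ψ) (u Φ) ∧
      Mcode.commutant.relEntropy Ψ Φ = Mphys.commutant.relEntropy (u Ψ) (u Φ)

/-- Every `O ∈ Mcode` has a reconstruction `R ∈ Mphys` which, for every fiducial vector `Φ`, is the
unique bounded operator with `R P' u Φ = P' u O Φ` for all `P' ∈ Mphys'`. -/
def ReconstructionFormula (u : Hcode →ₗᵢ[ℂ] Hphys) (Mcode : VonNeumannAlgebra Hcode)
    (Mphys : VonNeumannAlgebra Hphys) : Prop :=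
  ∀ O ∈ Mcode, ∃ R ∈ Mphys,
    (∀ Θ : Hcode, u (O Θ) = R (u Θ) ∧ u ((star O) Θ) = (star R) (u Θ)) ∧
    ∀ Φ : Hcode, Mcode.IsCyclicSeparating Φ → ∀ T : Hphys →L[ℂ] Hphys,
      (∀ P' ∈ Mphys.commutant, T (P' (u Φ)) = P' (u (O Φ))) ↔ T = R

end Codes

end

/-! From reconstruction to entropies. If `R ∈ Mphys`, reconstruction of `Mcode'` makes the
compression `u† R u` commute with `Mcode'`, so it lies in `Mcode`. Reconstruction of `Mcode` says
that `u` maps the graph of the bulk Tomita operator into the boundary one, and compression says that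
`u†` maps the boundary graph back. Together they give `u Δcode ⊆ Δphys u`, so `u` intertwines the
resolvents `(1 + Δ)⁻¹`, hence preserves spectral measures and entropies
(`HasReconstruction.relEntropy_eq`).

From entropies to reconstruction. A unitary `U'` of `Mcode'` does not change the state of `Ψ` on
`Mcode`, so the bulk relative entropy of `Ψ` and `U'Ψ` is zero; hence so is that of `uΨ` and `uU'Ψ`.
Equality in `log t ≤ t - 1` then forces `Δ uΨ = uΨ`, which says that these two vectors induce the
same state on `Mphys` (`inner_eq_of_relEntropy_eq_zero`). Thus `u† R u` commutes with the unitaries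
of `Mcode'`, which span it, and lies in `Mcode`. By the same argument for the commutants, a unitary
`V ∈ Mcode` does not change the state on `Mphys'`, so `P'uΨ ↦ P'uVΨ` extends to an isometry `R ∈
Mphys''`. Its compression is in `Mcode` and agrees with `V` on the separating vector `Ψ`, so `u† R u
= V`; as `R` preserves norms, `R u = u V` (`exists_reconstruction_of_unitary`).

The analytic groundwork concerns `Δ = S†S` for a closed antilinear `S`. Everything passes through
the bounded resolvent `B = (1 + Δ)⁻¹`, found by projecting onto the graph of `S`. The spectral
measure of `B`, transported by `t ↦ t⁻¹ - 1`, gives one for `Δ`; conversely the moments of `(1 +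
t)⁻¹` determine the scalar spectral measures, so the entropy does not depend on the chosen
projection-valued measure. -/

/-! ### Operators representing integrals against a family of measures -/

section Represents

variable {H : Type*} [NormedAddCommGroup H] [InnerProductSpace ℂ H] [CompleteSpace H]

/-- The quadratic form of `T` is `ψ ↦ ∫ f dμ_ψ`. -/
def IsRep (μ : H → Measure ℝ) (f : ℝ → ℝ) (T : H →L[ℂ] H) : Prop :=
  ∀ ψ : H, ⟪ψ, T ψ⟫_ℂ = ((∫ t, f t ∂(μ ψ) : ℝ) : ℂ)

theorem ContinuousLinearMap.ext_of_inner_self {S T : H →L[ℂ] H}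
    (h : ∀ ψ, ⟪ψ, S ψ⟫_ℂ = ⟪ψ, T ψ⟫_ℂ) : S = T := by
  have h1 : ((S - T : H →L[ℂ] H) : H →ₗ[ℂ] H) = 0 := by
    rw [← inner_map_self_eq_zero]
    intro x
    rw [← inner_conj_symm]
    simp [inner_sub_right, h]
  rw [← sub_eq_zero]
  ext x
  exact congrArg (fun f : H →ₗ[ℂ] H => f x) h1

theorem inner_right_polarization (T : H →L[ℂ] H) (x y : H) :
    ⟪x, T y⟫_ℂ = (⟪y + x, T (y + x)⟫_ℂ - ⟪y - x, T (y - x)⟫_ℂ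
      + Complex.I * ⟪y + Complex.I • x, T (y + Complex.I • x)⟫_ℂ
      - Complex.I * ⟪y - Complex.I • x, T (y - Complex.I • x)⟫_ℂ) / 4 := by
  simp only [map_add, map_sub, map_smul, inner_add_left, inner_add_right, inner_sub_left,
    inner_sub_right, inner_smul_left, inner_smul_right, Complex.conj_I]
  ring_nf
  simp only [Complex.I_sq]
  ring

theorem tendsto_inner_of_tendsto_inner_self {T : ℕ → H →L[ℂ] H} {S : H →L[ℂ] H}
    (h : ∀ ψ, Tendsto (fun n => ⟪ψ, T n ψ⟫_ℂ) atTop (𝓝 ⟪ψ, S ψ⟫_ℂ)) (x y : H) :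
    Tendsto (fun n => ⟪x, T n y⟫_ℂ) atTop (𝓝 ⟪x, S y⟫_ℂ) := by
  simp_rw [inner_right_polarization _ x y]
  exact ((((h _).sub (h _)).add ((h _).const_mul _)).sub ((h _).const_mul _)).div_const 4

/-- Limits of quadratic forms polarize to limits of all matrix elements; the uniform norm bound
makes the limiting sesquilinear form bounded, and the Riesz representation turns it into an
operator. -/
theorem exists_weak_limit {T : ℕ → H →L[ℂ] H} {C : ℝ} (hC : ∀ n, ‖T n‖ ≤ C)
    (h : ∀ ψ, ∃ c, Tendsto (fun n => ⟪ψ, T n ψ⟫_ℂ) atTop (𝓝 c)) :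
    ∃ S : H →L[ℂ] H, ∀ x y, Tendsto (fun n => ⟪x, T n y⟫_ℂ) atTop (𝓝 ⟪x, S y⟫_ℂ) := by
  choose q hq using h
  have hb : ∀ x y, ∃ c, Tendsto (fun n => ⟪x, T n y⟫_ℂ) atTop (𝓝 c) := fun x y => by
    simp_rw [inner_right_polarization _ x y]
    exact ⟨_, ((((hq _).sub (hq _)).add ((hq _).const_mul _)).sub
      ((hq _).const_mul _)).div_const 4⟩
  choose b hb using hb
  have huniq : ∀ {u : ℕ → ℂ} {a c : ℂ}, Tendsto u atTop (𝓝 a) → Tendsto u atTop (𝓝 c) → a = c :=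
    fun h h' => tendsto_nhds_unique h h'
  let b' : H →ₗ⋆[ℂ] H →ₗ[ℂ] ℂ := LinearMap.mk₂'ₛₗ (starRingEnd ℂ) (RingHom.id ℂ) b
    (fun x x' y => huniq (hb _ _) (by simpa only [inner_add_left] using (hb x y).add (hb x' y)))
    (fun c x y => huniq (hb _ _) (by
      simpa only [inner_smul_left, smul_eq_mul] using (hb x y).const_mul (starRingEnd ℂ c)))
    (fun x y y' => huniq (hb _ _) (by
      simpa only [map_add, inner_add_right] using (hb x y).add (hb x y')))
    (fun c x y => huniq (hb _ _) (by
      simpa only [map_smul, inner_smul_right, smul_eq_mul, RingHom.id_apply] using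
        (hb x y).const_mul c))
  have hbound : ∀ x y, ‖b' x y‖ ≤ C * ‖x‖ * ‖y‖ := fun x y =>
    le_of_tendsto (hb x y).norm (Eventually.of_forall fun n =>
      calc ‖⟪x, T n y⟫_ℂ‖ ≤ ‖x‖ * ‖T n y‖ := norm_inner_le_norm _ _
        _ ≤ ‖x‖ * (C * ‖y‖) := by
          gcongr
          exact (T n).le_of_opNorm_le (hC n) y
        _ = C * ‖x‖ * ‖y‖ := by ring)
  let B := LinearMap.mkContinuous₂ b' C hbound
  -- The Riesz operator sits in the left slot of the inner product; the adjoint moves it to the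
  -- right one.
  refine ⟨ContinuousLinearMap.adjoint (InnerProductSpace.continuousLinearMapOfBilin B),
    fun x y => ?_⟩
  rw [ContinuousLinearMap.adjoint_inner_right,
    InnerProductSpace.continuousLinearMapOfBilin_apply]
  exact hb x y

namespace IsRep

variable {μ : H → Measure ℝ} {f g : ℝ → ℝ} {S T : H →L[ℂ] H}

theorem unique (h : IsRep μ f S) (h' : IsRep μ f T) : S = T :=
  ContinuousLinearMap.ext_of_inner_self fun ψ => by rw [h ψ, h' ψ]

theorem congr (h : IsRep μ f T) (hfg : ∀ t, f t = g t) : IsRep μ g T := by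
  rwa [← funext hfg]

theorem isSelfAdjoint (h : IsRep μ f T) : IsSelfAdjoint T := by
  rw [ContinuousLinearMap.isSelfAdjoint_iff']
  refine ContinuousLinearMap.ext_of_inner_self fun ψ => ?_
  rw [ContinuousLinearMap.adjoint_inner_right, ← inner_conj_symm, h ψ, Complex.conj_ofReal]

theorem inner_left (h : IsRep μ f T) (x y : H) : ⟪T x, y⟫_ℂ = ⟪x, T y⟫_ℂ := by
  conv_lhs => rw [← ContinuousLinearMap.isSelfAdjoint_iff'.1 h.isSelfAdjoint]
  exact ContinuousLinearMap.adjoint_inner_left _ _ _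

theorem add (h : IsRep μ f S) (h' : IsRep μ g T) (hf : ∀ ψ, Integrable f (μ ψ))
    (hg : ∀ ψ, Integrable g (μ ψ)) : IsRep μ (fun t => f t + g t) (S + T) := fun ψ => by
  rw [integral_add (hf ψ) (hg ψ)]
  simp [h ψ, h' ψ]

theorem sub (h : IsRep μ f S) (h' : IsRep μ g T) (hf : ∀ ψ, Integrable f (μ ψ))
    (hg : ∀ ψ, Integrable g (μ ψ)) : IsRep μ (fun t => f t - g t) (S - T) := fun ψ => by
  rw [integral_sub (hf ψ) (hg ψ)]
  simp [h ψ, h' ψ]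

theorem const_smul (h : IsRep μ f T) (c : ℝ) : IsRep μ (fun t => c * f t) (c • T) := fun ψ => by
  rw [integral_const_mul, smul_apply, ← Complex.coe_smul, inner_smul_right,
    h ψ]
  push_cast
  rfl

theorem sum {ι : Type*} {s : Finset ι} {f : ι → ℝ → ℝ} {T : ι → H →L[ℂ] H}
    (h : ∀ i ∈ s, IsRep μ (f i) (T i)) (hf : ∀ i ∈ s, ∀ ψ, Integrable (f i) (μ ψ)) :
    IsRep μ (fun t => ∑ i ∈ s, f i t) (∑ i ∈ s, T i) := fun ψ => by
  rw [integral_finsetSum _ (fun i hi => hf i hi ψ), sum_apply, inner_sum]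
  push_cast
  exact Finset.sum_congr rfl fun i hi => h i hi ψ

theorem norm_le_one (h : IsRep μ f T) (hμ : ∀ ψ, μ ψ Set.univ = ENNReal.ofReal (‖ψ‖ ^ 2))
    (h0 : ∀ t, 0 ≤ f t) (h1 : ∀ t, f t ≤ 1) : ‖T‖ ≤ 1 := by
  have hfin : ∀ ψ, IsFiniteMeasure (μ ψ) := fun ψ => ⟨by rw [hμ]; exact ENNReal.ofReal_lt_top⟩
  have hpos : (0 : H →L[ℂ] H) ≤ T := by
    rw [ContinuousLinearMap.nonneg_iff_isPositive,
      ContinuousLinearMap.isPositive_iff_complex]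
    intro x
    rw [← inner_conj_symm, h x]
    simpa using integral_nonneg (μ := μ x) (fun t => h0 t)
  rw [CStarAlgebra.norm_le_iff_le_algebraMap T zero_le_one hpos, map_one,
    ContinuousLinearMap.le_def, ContinuousLinearMap.isPositive_iff_complex]
  intro x
  have hx : ∫ t, f t ∂(μ x) ≤ ‖x‖ ^ 2 := by
    by_cases hf : Integrable f (μ x)
    · calc ∫ t, f t ∂(μ x) ≤ ∫ t, (1 : ℝ) ∂(μ x) := integral_mono hf (integrable_const _) h1
        _ = ‖x‖ ^ 2 := by simp [Measure.real, hμ]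
    -- No measurability is assumed, so the integral may take its default value `0`.
    · rw [integral_undef hf]; positivity
  have : ⟪(1 - T) x, x⟫_ℂ = ((‖x‖ ^ 2 - ∫ t, f t ∂(μ x) : ℝ) : ℂ) := by
    rw [← inner_conj_symm]
    simp only [sub_apply, one_apply_eq_self, inner_sub_right, h x,
      inner_self_eq_norm_sq_to_K]
    simp
  rw [this]
  have hre : (((‖x‖ : ℂ) ^ 2).re : ℝ) = ‖x‖ ^ 2 := by rw [← Complex.ofReal_pow, Complex.ofReal_re]
  exact ⟨by simp [hre], by simpa [hre] using hx⟩

theorem tendsto_inner {f : ℕ → ℝ → ℝ} {g : ℝ → ℝ} {T : ℕ → H →L[ℂ] H}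
    (hμ : ∀ ψ, μ ψ Set.univ = ENNReal.ofReal (‖ψ‖ ^ 2))
    (h : ∀ n, IsRep μ (f n) (T n)) (h' : IsRep μ g S) (hm : ∀ n, Measurable (f n))
    (hb : ∀ n t, |f n t| ≤ 1) (hlim : ∀ t, Tendsto (fun n => f n t) atTop (𝓝 (g t))) (x y : H) :
    Tendsto (fun n => ⟪x, T n y⟫_ℂ) atTop (𝓝 ⟪x, S y⟫_ℂ) := by
  have hfin : ∀ ψ, IsFiniteMeasure (μ ψ) := fun ψ => ⟨by rw [hμ]; exact ENNReal.ofReal_lt_top⟩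
  refine tendsto_inner_of_tendsto_inner_self (fun ψ => ?_) x y
  simp_rw [h _ ψ, h' ψ]
  exact (Complex.continuous_ofReal.tendsto _).comp
    (tendsto_integral_of_dominated_convergence (fun _ => 1)
      (fun n => (hm n).aestronglyMeasurable) (integrable_const _)
      (fun n => Eventually.of_forall (hb n)) (Eventually.of_forall hlim))

theorem exists_limit {f : ℕ → ℝ → ℝ} {g : ℝ → ℝ} {T : ℕ → H →L[ℂ] H}
    (hμ : ∀ ψ, μ ψ Set.univ = ENNReal.ofReal (‖ψ‖ ^ 2))
    (h : ∀ n, IsRep μ (f n) (T n)) (hm : ∀ n, Measurable (f n))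
    (h0 : ∀ n t, 0 ≤ f n t) (h1 : ∀ n t, f n t ≤ 1)
    (hlim : ∀ t, Tendsto (fun n => f n t) atTop (𝓝 (g t))) : ∃ S, IsRep μ g S := by
  have hfin : ∀ ψ, IsFiniteMeasure (μ ψ) := fun ψ => ⟨by rw [hμ]; exact ENNReal.ofReal_lt_top⟩
  have hψ : ∀ ψ, Tendsto (fun n => ⟪ψ, T n ψ⟫_ℂ) atTop (𝓝 ((∫ t, g t ∂(μ ψ) : ℝ) : ℂ)) := by
    intro ψ
    simp_rw [h _ ψ]
    exact (Complex.continuous_ofReal.tendsto _).comp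
      (tendsto_integral_of_dominated_convergence (fun _ => 1)
        (fun n => (hm n).aestronglyMeasurable) (integrable_const _)
        (fun n => Eventually.of_forall fun t => by
          rw [Real.norm_eq_abs, abs_of_nonneg (h0 n t)]; exact h1 n t) (Eventually.of_forall hlim))
  obtain ⟨S, hS⟩ := exists_weak_limit (fun n => (h n).norm_le_one hμ (h0 n) (h1 n))
    (fun ψ => ⟨_, hψ ψ⟩)
  exact ⟨S, fun ψ => tendsto_nhds_unique (hS ψ ψ) (hψ ψ)⟩

/-- Weak convergence survives right multiplication by a fixed operator, so a product rule may be
passed to the limit in one factor at a time. -/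
theorem mul_of_tendsto {f : ℕ → ℝ → ℝ} {g h k : ℝ → ℝ} {T : ℕ → H →L[ℂ] H}
    {A : H →L[ℂ] H} (hμ : ∀ ψ, μ ψ Set.univ = ENNReal.ofReal (‖ψ‖ ^ 2))
    (hT : ∀ n, IsRep μ (f n) (T n)) (hS : IsRep μ g S) (hm : ∀ n, Measurable (f n))
    (hb : ∀ n t, |f n t| ≤ 1) (hlim : ∀ t, Tendsto (fun n => f n t) atTop (𝓝 (g t)))
    (hh : Measurable h) (hh1 : ∀ t, |h t| ≤ 1)
    (hA : ∀ n, IsRep μ (fun t => f n t * h t) (T n * A)) (hk : ∀ t, g t * h t = k t) :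
    IsRep μ k (S * A) := fun ψ => by
  have hfin : ∀ ψ, IsFiniteMeasure (μ ψ) := fun ψ => ⟨by rw [hμ]; exact ENNReal.ofReal_lt_top⟩
  have h1 : Tendsto (fun n => ⟪ψ, (T n * A) ψ⟫_ℂ) atTop (𝓝 ⟪ψ, (S * A) ψ⟫_ℂ) :=
    tendsto_inner hμ hT hS hm hb hlim ψ (A ψ)
  refine tendsto_nhds_unique h1 ?_
  simp_rw [hA _ ψ]
  refine (Complex.continuous_ofReal.tendsto _).comp
      (tendsto_integral_of_dominated_convergence (fun _ => 1)
        (fun n => ((hm n).mul hh).aestronglyMeasurable) (integrable_const _)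
        (fun n => Eventually.of_forall fun t => ?_) (Eventually.of_forall fun t => ?_))
  · rw [Real.norm_eq_abs, abs_mul]
    exact mul_le_one₀ (hb n t) (abs_nonneg _) (hh1 t)
  · rw [← hk]
    exact (hlim t).mul_const _

end IsRep

end Represents

/-! ### The spectral theorem for bounded self-adjoint operators -/

section SpectralMeasure

variable {H : Type*} [NormedAddCommGroup H] [InnerProductSpace ℂ H] [CompleteSpace H]

/-- Representing a real function makes `S`, `T` and `S * T` self-adjoint, so `S` and `T` commute. -/
theorem IsRep.mul_swap {μ : H → Measure ℝ} {f g k : ℝ → ℝ} {S T : H →L[ℂ] H}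
    (hS : IsRep μ f S) (hT : IsRep μ g T) (hk : IsRep μ k (S * T)) : IsRep μ k (T * S) := by
  have h := hk.isSelfAdjoint.star_eq
  rw [star_mul, hS.isSelfAdjoint.star_eq, hT.isSelfAdjoint.star_eq] at h
  rwa [h]

theorem isRep_one {μ : H → Measure ℝ} (hμ : ∀ ψ, μ ψ Set.univ = ENNReal.ofReal (‖ψ‖ ^ 2)) :
    IsRep μ (fun _ => 1) (1 : H →L[ℂ] H) := fun ψ => by
  simp [Measure.real, hμ]

/-- If `κ` is a multiplicative calculus on continuous functions represented by `μ`, then every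
indicator function is represented, compatibly with right multiplication by `A`. -/
theorem exists_isRep_indicator {μ : H → Measure ℝ} {κ : (ℝ → ℝ) → H →L[ℂ] H}
    (hμ : ∀ ψ, μ ψ Set.univ = ENNReal.ofReal (‖ψ‖ ^ 2))
    (hκ : ∀ f, Continuous f → IsRep μ f (κ f)) {h : ℝ → ℝ} {A : H →L[ℂ] H} (hh : Measurable h)
    (hh1 : ∀ t, |h t| ≤ 1)
    (hA : ∀ f, Continuous f → (∀ t, |f t| ≤ 1) → IsRep μ (fun t => f t * h t) (κ f * A))
    {s : Set ℝ} (hs : MeasurableSet s) :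
    ∃ T, IsRep μ (s.indicator fun _ => 1) T ∧
      IsRep μ (fun t => s.indicator (fun _ => 1) t * h t) (T * A) := by
  have hfin : ∀ ψ, IsFiniteMeasure (μ ψ) := fun ψ => ⟨by rw [hμ]; exact ENNReal.ofReal_lt_top⟩
  have hint : ∀ {s : Set ℝ}, MeasurableSet s → ∀ ψ,
      Integrable (s.indicator fun _ => (1 : ℝ)) (μ ψ) := fun hs ψ =>
    (integrable_const _).indicator hs
  have hhint : ∀ ψ, Integrable h (μ ψ) := fun ψ =>
    (integrable_const (1 : ℝ)).mono' hh.aestronglyMeasurable (Eventually.of_forall hh1)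
  have hinth : ∀ {s : Set ℝ}, MeasurableSet s → ∀ ψ,
      Integrable (fun t => s.indicator (fun _ => (1 : ℝ)) t * h t) (μ ψ) := fun {s} hs ψ => by
    have : (fun t => s.indicator (fun _ => (1 : ℝ)) t * h t) = s.indicator h := by
      ext t; by_cases ht : t ∈ s <;> simp [ht]
    rw [this]
    exact (hhint ψ).indicator hs
  have hκ1 : κ (fun _ => 1) = 1 := (hκ _ continuous_const).unique (isRep_one hμ)
  have hA1 : IsRep μ h A := by
    have := hA (fun _ => 1) continuous_const (by simp)
    rw [hκ1, one_mul] at this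
    exact this.congr fun t => one_mul _
  -- Dynkin induction from closed sets, whose indicators are decreasing limits of continuous
  -- functions. The product with `A` is carried along at every stage.
  induction s, hs using MeasurableSpace.induction_on_inter
    (h_eq := (BorelSpace.measurable_eq (α := ℝ)).trans borel_eq_generateFrom_isClosed)
    (h_inter := isPiSystem_isClosed) with
  | empty => exact ⟨0, fun ψ => by simp, fun ψ => by simp⟩
  | basic F hF =>
    replace hF : IsClosed F := hF
    let f : ℕ → ℝ → ℝ := fun n t => hF.apprSeq n t
    have hfc : ∀ n, Continuous (f n) := fun n =>
      NNReal.continuous_coe.comp (hF.apprSeq n).continuous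
    have hf0 : ∀ n t, 0 ≤ f n t := fun n t => NNReal.coe_nonneg _
    have hf1 : ∀ n t, f n t ≤ 1 := fun n t => by
      exact_mod_cast HasOuterApproxClosed.apprSeq_apply_le_one hF n t
    have hfa : ∀ n t, |f n t| ≤ 1 := fun n t => by rw [abs_of_nonneg (hf0 n t)]; exact hf1 n t
    have hlim : ∀ t, Tendsto (fun n => f n t) atTop (𝓝 (F.indicator (fun _ => 1) t)) := fun t => by
      have h1 := tendsto_pi_nhds.1 (HasOuterApproxClosed.tendsto_apprSeq hF) t
      have h2 := (NNReal.continuous_coe.tendsto _).comp h1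
      have h3 : ((F.indicator (fun _ => (1 : NNReal)) t : NNReal) : ℝ)
          = F.indicator (fun _ => (1 : ℝ)) t := by
        by_cases ht : t ∈ F <;> simp [ht]
      rw [h3] at h2
      exact h2
    obtain ⟨S, hS⟩ := IsRep.exists_limit hμ (fun n => hκ (f n) (hfc n))
      (fun n => (hfc n).measurable) hf0 hf1 hlim
    exact ⟨S, hS, IsRep.mul_of_tendsto hμ (fun n => hκ (f n) (hfc n)) hS
      (fun n => (hfc n).measurable) hfa hlim hh hh1 (fun n => hA _ (hfc n) (hfa n))
      (fun t => rfl)⟩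
  | compl s hs ih =>
    obtain ⟨T, hT, hTA⟩ := ih
    refine ⟨1 - T, ?_, ?_⟩
    · refine ((isRep_one hμ).sub hT (fun ψ => integrable_const _) (hint hs)).congr fun t => ?_
      by_cases ht : t ∈ s <;> simp [ht]
    · rw [sub_mul, one_mul]
      refine (hA1.sub hTA hhint (hinth hs)).congr fun t => ?_
      by_cases ht : t ∈ s <;> simp [ht]
  | iUnion s hd hs ih =>
    choose T hT hTA using ih
    have hind : ∀ n t, ∑ k ∈ Finset.range n, (s k).indicator (fun _ => (1 : ℝ)) t
        = (⋃ k ∈ Finset.range n, s k).indicator (fun _ => 1) t := fun n t => by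
      rw [Finset.indicator_biUnion _ _ fun i _ j _ hij => hd hij]
    have hm : ∀ n, MeasurableSet (⋃ k ∈ Finset.range n, s k) := fun n =>
      Finset.measurableSet_biUnion _ fun k _ => hs k
    have h1 : ∀ n, IsRep μ ((⋃ k ∈ Finset.range n, s k).indicator fun _ => 1)
        (∑ k ∈ Finset.range n, T k) := fun n =>
      (IsRep.sum (fun k _ => hT k) (fun k _ => hint (hs k))).congr (hind n)
    have h2 : ∀ n, IsRep μ (fun t => (⋃ k ∈ Finset.range n, s k).indicator (fun _ => 1) t * h t)
        ((∑ k ∈ Finset.range n, T k) * A) := fun n => by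
      rw [Finset.sum_mul]
      refine (IsRep.sum (fun k _ => hTA k) (fun k _ => hinth (hs k))).congr fun t => ?_
      rw [← hind, Finset.sum_mul]
    have hlim : ∀ t, Tendsto (fun n => (⋃ k ∈ Finset.range n, s k).indicator (fun _ => (1 : ℝ)) t)
        atTop (𝓝 ((⋃ k, s k).indicator (fun _ => 1) t)) := fun t =>
      ((tendsto_indicator_biUnion_finset s _ t).comp tendsto_finset_range).mono_right
        (pure_le_nhds _)
    have h0 : ∀ n t, 0 ≤ (⋃ k ∈ Finset.range n, s k).indicator (fun _ => (1 : ℝ)) t := fun n t =>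
      Set.indicator_nonneg (fun _ _ => zero_le_one) t
    have h1' : ∀ n t, (⋃ k ∈ Finset.range n, s k).indicator (fun _ => (1 : ℝ)) t ≤ 1 := fun n t =>
      Set.indicator_le' (fun _ _ => le_rfl) (fun _ _ => zero_le_one) t
    have hmeas : ∀ n, Measurable ((⋃ k ∈ Finset.range n, s k).indicator fun _ => (1 : ℝ)) :=
      fun n => measurable_const.indicator (hm n)
    obtain ⟨S, hS⟩ := IsRep.exists_limit hμ h1 hmeas h0 h1' hlim
    exact ⟨S, hS, IsRep.mul_of_tendsto hμ h1 hS hmeas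
      (fun n t => by rw [abs_of_nonneg (h0 n t)]; exact h1' n t) hlim hh hh1 h2 (fun t => rfl)⟩

theorem ProjectionValuedMeasure.measure_apply (P : ProjectionValuedMeasure H) (ψ : H) {s : Set ℝ}
    (hs : MeasurableSet s) : P.measure ψ s = ENNReal.ofReal (⟪ψ, P.proj s ψ⟫_ℂ).re :=
  Measure.ofMeasurable_apply s hs

open scoped Classical in
/-- A family of measures representing a multiplicative calculus on continuous functions comes from
a projection-valued measure. -/
theorem exists_projectionValuedMeasure {μ : H → Measure ℝ} {κ : (ℝ → ℝ) → H →L[ℂ] H}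
    (hμ : ∀ ψ, μ ψ Set.univ = ENNReal.ofReal (‖ψ‖ ^ 2))
    (hκ : ∀ f, Continuous f → IsRep μ f (κ f))
    (hmul : ∀ f g, Continuous f → Continuous g → κ (fun t => f t * g t) = κ f * κ g) :
    ∃ P : ProjectionValuedMeasure H, ∀ ψ, P.measure ψ = μ ψ := by
  have hfin : ∀ ψ, IsFiniteMeasure (μ ψ) := fun ψ => ⟨by rw [hμ]; exact ENNReal.ofReal_lt_top⟩
  have hint : ∀ {s : Set ℝ}, MeasurableSet s → ∀ ψ,
      Integrable (s.indicator fun _ => (1 : ℝ)) (μ ψ) := fun hs ψ =>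
    (integrable_const _).indicator hs
  have hex : ∀ s, MeasurableSet s → ∃ T, IsRep μ (s.indicator fun _ => 1) T := fun s hs => by
    obtain ⟨T, hT, -⟩ := exists_isRep_indicator (A := 1) hμ hκ (measurable_const (a := (1 : ℝ)))
      (by simp) (fun f hf _ => by rw [mul_one]; exact (hκ f hf).congr fun t => (mul_one _).symm) hs
    exact ⟨T, hT⟩
  let E : Set ℝ → H →L[ℂ] H := fun s => if hs : MeasurableSet s then (hex s hs).choose else 0
  have hE : ∀ s, MeasurableSet s → IsRep μ (s.indicator fun _ => 1) (E s) := fun s hs => by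
    simp only [E, dif_pos hs]
    exact (hex s hs).choose_spec
  -- Multiplicativity is extended in two rounds: one factor becomes an indicator here (with `A = κ
  -- f`), and both do in `hinter` (with `A = E t`).
  have hcont : ∀ s, MeasurableSet s → ∀ f, Continuous f → (∀ t, |f t| ≤ 1) →
      IsRep μ (fun t => f t * s.indicator (fun _ => 1) t) (κ f * E s) := fun s hs f hf hf1 => by
    obtain ⟨T, hT, hTf⟩ := exists_isRep_indicator (A := κ f) hμ hκ hf.measurable hf1
      (fun g hg _ => by rw [← hmul g f hg hf]; exact hκ _ (hg.mul hf)) hs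
    rw [hT.unique (hE s hs)] at hTf
    exact ((hE s hs).mul_swap (hκ f hf) hTf).congr fun t => mul_comm _ _
  have hinter : ∀ s t, MeasurableSet s → MeasurableSet t → E s * E t = E (s ∩ t) := by
    intro s t hs ht
    obtain ⟨T, hT, hTt⟩ := exists_isRep_indicator (A := E t) hμ hκ
      (measurable_const.indicator ht) (fun x => by by_cases hx : x ∈ t <;> simp [hx])
      (fun f hf hf1 => hcont t ht f hf hf1) hs
    rw [hT.unique (hE s hs)] at hTt
    refine hTt.unique ((hE _ (hs.inter ht)).congr fun x => ?_)
    by_cases hx : x ∈ s <;> by_cases hx' : x ∈ t <;> simp [hx, hx']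
  have hproj : ∀ s, MeasurableSet s → IsStarProjection (E s) := fun s hs =>
    ⟨by rw [IsIdempotentElem, hinter s s hs hs, Set.inter_self], (hE s hs).isSelfAdjoint⟩
  have hval : ∀ s, MeasurableSet s → ∀ ψ, ⟪ψ, E s ψ⟫_ℂ = ((μ ψ).real s : ℂ) := fun s hs ψ => by
    rw [hE s hs ψ, integral_indicator_const _ hs]
    simp
  have hnorm : ∀ s, MeasurableSet s → ∀ ψ, ‖E s ψ‖ ^ 2 = (μ ψ).real s := fun s hs ψ => by
    have h1 : ⟪E s ψ, E s ψ⟫_ℂ = ⟪ψ, E s ψ⟫_ℂ := by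
      rw [(hE s hs).inner_left, ← mul_apply_eq_comp, hinter s s hs hs, Set.inter_self]
    rw [← inner_self_eq_norm_sq (𝕜 := ℂ), h1, hval s hs]
    simp
  let P : ProjectionValuedMeasure H :=
    { proj := E
      isStarProjection := hproj
      proj_empty := (hE ∅ .empty).unique (fun ψ => by simp)
      proj_univ := (hE _ .univ).unique ((isRep_one hμ).congr (by simp))
      proj_inter := hinter
      -- The remainder after finitely many sets is the projection of the uncovered set; the squared
      -- norm of its value at `ψ` is the measure of that set, which tends to zero.
      hasSum_proj := by
        intro s hs hd ψ
        have hU : MeasurableSet (⋃ n, s n) := .iUnion hs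
        have hFm : ∀ F : Finset ℕ, MeasurableSet (⋃ k ∈ F, s k) := fun F =>
          Finset.measurableSet_biUnion _ fun k _ => hs k
        have hdiff : ∀ F : Finset ℕ, E (⋃ n, s n) - ∑ k ∈ F, E (s k)
            = E ((⋃ n, s n) \ ⋃ k ∈ F, s k) := fun F => by
          refine IsRep.unique (((hE _ hU).sub (IsRep.sum (fun k _ => hE _ (hs k))
            (fun k _ => hint (hs k))) (hint hU) (fun ψ =>
              integrable_finsetSum _ fun k _ => hint (hs k) ψ)).congr fun t => ?_)
            (hE _ (hU.diff (hFm F)))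
          have h1 := congrFun (Finset.indicator_biUnion F s (f := fun _ => (1 : ℝ))
            fun i _ j _ hij => hd hij) t
          rw [← h1, Set.indicator_sdiff (Set.iUnion₂_subset fun k _ => Set.subset_iUnion s k)]
          rfl
        have hsum : HasSum (fun n => (μ ψ).real (s n)) ((μ ψ).real (⋃ n, s n)) := by
          have hsm : ∑' n, μ ψ (s n) ≠ ∞ := by
            rw [← measure_iUnion hd hs]; exact measure_ne_top _ _
          have := ENNReal.hasSum_toReal hsm
          rwa [← ENNReal.tsum_toReal_eq (fun n => measure_ne_top _ _),
            ← measure_iUnion hd hs] at this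
        rw [HasSum, SummationFilter.unconditional_filter, tendsto_iff_norm_sub_tendsto_zero]
        have h0 : Tendsto (fun F : Finset ℕ => √((μ ψ).real (⋃ n, s n)
            - ∑ k ∈ F, (μ ψ).real (s k))) atTop (𝓝 0) := by
          have h2 : Tendsto (fun F : Finset ℕ => (μ ψ).real (⋃ n, s n)
            - ∑ k ∈ F, (μ ψ).real (s k)) atTop (𝓝 0) := by
            simpa using (tendsto_const_nhds (x := (μ ψ).real (⋃ n, s n))).sub hsum
          simpa using h2.sqrt
        refine h0.congr fun F => ?_
        have h3 : ‖E ((⋃ n, s n) \ ⋃ k ∈ F, s k) ψ‖ ^ 2 = (μ ψ).real (⋃ n, s n)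
            - ∑ k ∈ F, (μ ψ).real (s k) := by
          rw [hnorm _ (hU.diff (hFm F)), measureReal_sdiff (Set.iUnion₂_subset fun k _ =>
            Set.subset_iUnion s k) (hFm F),
            measureReal_biUnion_finset (fun i _ j _ hij => hd hij) (fun k _ => hs k)]
        rw [← h3, Real.sqrt_sq (norm_nonneg _), ← hdiff, norm_sub_rev]
        simp }
  refine ⟨P, fun ψ => Measure.ext fun s hs => ?_⟩
  rw [P.measure_apply ψ hs]
  change ENNReal.ofReal (⟪ψ, E s ψ⟫_ℂ).re = _
  rw [hval s hs, Complex.ofReal_re, ofReal_measureReal]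

/-- The spectral measures of a bounded self-adjoint operator. -/
theorem exists_measure_isRep_cfc (B : H →L[ℂ] H) (hB : IsSelfAdjoint B) :
    ∃ μ : H → Measure ℝ, (∀ ψ, μ ψ Set.univ = ENNReal.ofReal (‖ψ‖ ^ 2)) ∧
      (∀ f : ℝ → ℝ, Continuous f → IsRep μ f (cfc f B)) ∧
      ∀ (f : ℝ → ℝ) (ψ : H), Continuous f → Integrable f (μ ψ) := by
  -- For each `ψ`, Riesz–Markov–Kakutani applies to this positive functional on the compact
  -- spectrum. The measures are then pushed forward to `ℝ`; compact support makes all continuous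
  -- functions integrable.
  let Λ : H → (CompactlySupportedContinuousMap (spectrum ℝ B) ℝ →ₚ[ℝ] ℝ) := fun ψ =>
    { toFun := fun f => (⟪ψ, cfcHom hB (f : C(spectrum ℝ B, ℝ)) ψ⟫_ℂ).re
      map_add' := fun f g => by
        have : ((f + g : CompactlySupportedContinuousMap (spectrum ℝ B) ℝ) : C(spectrum ℝ B, ℝ))
            = f + g := rfl
        rw [this, map_add]
        simp
      map_smul' := fun c f => by
        have : ((c • f : CompactlySupportedContinuousMap (spectrum ℝ B) ℝ) : C(spectrum ℝ B, ℝ))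
            = c • (f : C(spectrum ℝ B, ℝ)) := rfl
        rw [this, map_smul, smul_apply, ← Complex.coe_smul, inner_smul_right]
        simp
      monotone' := fun f g hfg => by
        have h1 : cfcHom hB (f : C(spectrum ℝ B, ℝ)) ≤ cfcHom hB (g : C(spectrum ℝ B, ℝ)) :=
          cfcHom_mono hB hfg
        have h2 := (ContinuousLinearMap.le_def _ _).1 h1
        have h3 := h2.re_inner_nonneg_right ψ
        simpa [inner_sub_right] using h3 }
  let ν : H → Measure (spectrum ℝ B) := fun ψ => RealRMK.rieszMeasure (Λ ψ)
  have hself : ∀ (f : ℝ → ℝ) (ψ : H), ((⟪ψ, cfc f B ψ⟫_ℂ).re : ℂ) = ⟪ψ, cfc f B ψ⟫_ℂ := fun f ψ => by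
    have h : IsSelfAdjoint (cfc f B) := cfc_predicate f B
    rw [ContinuousLinearMap.isSelfAdjoint_iff'] at h
    refine Complex.conj_eq_iff_re.1 ?_
    rw [inner_conj_symm]
    conv_lhs => rw [← h]
    exact ContinuousLinearMap.adjoint_inner_left _ _ _
  have hrep : ∀ f : ℝ → ℝ, Continuous f → IsRep (fun ψ => (ν ψ).map Subtype.val) f (cfc f B) := by
    intro f hf ψ
    let g : CompactlySupportedContinuousMap (spectrum ℝ B) ℝ :=
      ⟨⟨(spectrum ℝ B).domRestrict f, hf.continuousOn.domRestrict⟩, .of_compactSpace _⟩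
    have h1 : ∫ t, f t ∂((ν ψ).map Subtype.val) = Λ ψ g := by
      rw [integral_map measurable_subtype_coe.aemeasurable hf.aestronglyMeasurable]
      exact RealRMK.integral_rieszMeasure (Λ ψ) g
    have h2 : Λ ψ g = (⟪ψ, cfc f B ψ⟫_ℂ).re := by
      rw [cfc_apply f B hB hf.continuousOn]
      rfl
    rw [h1, h2, hself]
  refine ⟨fun ψ => (ν ψ).map Subtype.val, fun ψ => ?_, hrep, fun f ψ hf => ?_⟩
  · have h := hrep (fun _ => 1) continuous_const ψ
    rw [cfc_const_one ℝ B] at h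
    simp only [one_apply_eq_self, inner_self_eq_norm_sq_to_K, integral_const, smul_eq_mul,
      mul_one] at h
    have h' : ‖ψ‖ ^ 2 = ((ν ψ).map Subtype.val).real Set.univ := by
      rw [← inner_self_eq_norm_sq (𝕜 := ℂ), inner_self_eq_norm_sq_to_K, h]
      simp
    rw [h', ofReal_measureReal]
  · rw [integrable_map_measure hf.aestronglyMeasurable measurable_subtype_coe.aemeasurable]
    exact (BoundedContinuousFunction.mkOfCompact
      ⟨f ∘ Subtype.val, hf.comp continuous_subtype_val⟩).integrable _

end SpectralMeasure

/-! ### Functional calculus of a projection-valued measure -/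

namespace ProjectionValuedMeasure

variable {H : Type*} [NormedAddCommGroup H] [InnerProductSpace ℂ H] [CompleteSpace H]
  (P : ProjectionValuedMeasure H)

theorem measure_univ (ψ : H) : P.measure ψ Set.univ = ENNReal.ofReal (‖ψ‖ ^ 2) := by
  rw [P.measure_apply ψ .univ, P.proj_univ, one_apply_eq_self, ← inner_self_eq_norm_sq (𝕜 := ℂ)]
  rfl

instance isFiniteMeasure_measure (ψ : H) : IsFiniteMeasure (P.measure ψ) :=
  ⟨by rw [P.measure_univ]; exact ENNReal.ofReal_lt_top⟩

theorem inner_proj_left {s : Set ℝ} (hs : MeasurableSet s) (x y : H) :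
    ⟪P.proj s x, y⟫_ℂ = ⟪x, P.proj s y⟫_ℂ := by
  have h := (P.isStarProjection s hs).isSelfAdjoint
  rw [ContinuousLinearMap.isSelfAdjoint_iff'] at h
  conv_lhs => rw [← h]
  exact ContinuousLinearMap.adjoint_inner_left _ _ _

theorem inner_proj_self {s : Set ℝ} (hs : MeasurableSet s) (ψ : H) :
    ⟪ψ, P.proj s ψ⟫_ℂ = ((P.measure ψ).real s : ℂ) := by
  rw [Measure.real, P.measure_apply ψ hs, ENNReal.toReal_ofReal (P.re_inner_nonneg ψ hs)]
  refine (Complex.conj_eq_iff_re.1 ?_).symm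
  rw [inner_conj_symm, P.inner_proj_left hs]

theorem isRep_proj {s : Set ℝ} (hs : MeasurableSet s) :
    IsRep P.measure (s.indicator fun _ => 1) (P.proj s) := fun ψ => by
  rw [P.inner_proj_self hs, integral_indicator_const _ hs]
  simp

theorem proj_mul_proj {s t : Set ℝ} (hs : MeasurableSet s) (ht : MeasurableSet t) :
    P.proj s * P.proj t = P.proj (s ∩ t) := P.proj_inter s t hs ht

theorem measure_proj {s : Set ℝ} (hs : MeasurableSet s) (ψ : H) :
    P.measure (P.proj s ψ) = (P.measure ψ).restrict s := by
  refine Measure.ext fun t ht => ?_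
  rw [P.measure_apply _ ht, Measure.restrict_apply ht, P.measure_apply _ (ht.inter hs),
    P.inner_proj_left hs, ← mul_apply_eq_comp, ← mul_apply_eq_comp, mul_assoc,
    P.proj_mul_proj ht hs, P.proj_mul_proj hs (ht.inter hs)]
  congr 5
  ext x
  simp +contextual

/-- `T` represents `f`, compatibly with all spectral projections. -/
def Represents (f : ℝ → ℝ) (T : H →L[ℂ] H) : Prop :=
  ∀ s, MeasurableSet s → IsRep P.measure (fun t => s.indicator (fun _ => 1) t * f t) (P.proj s * T)

variable {P}

theorem Represents.isRep {f : ℝ → ℝ} {T : H →L[ℂ] H} (h : P.Represents f T) :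
    IsRep P.measure f T := by
  have := h Set.univ .univ
  rw [P.proj_univ, one_mul] at this
  exact this.congr fun t => by simp

theorem Represents.one : P.Represents (fun _ => 1) (1 : H →L[ℂ] H) := fun s hs => by
  rw [mul_one]
  exact (P.isRep_proj hs).congr fun t => (mul_one _).symm

theorem Represents.comm {f : ℝ → ℝ} {T : H →L[ℂ] H} (h : P.Represents f T) {s : Set ℝ}
    (hs : MeasurableSet s) : P.proj s * T = T * P.proj s :=
  (h s hs).unique ((P.isRep_proj hs).mul_swap h.isRep (h s hs))

/-- Since `T` is self-adjoint and commutes with the spectral projections, `⟪Tψ, P(s)Tψ⟫ = ⟪ψ,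
P(s)T²ψ⟫`. This is what decides whether `Tψ` lies in the domain of an unbounded operator. -/
theorem Represents.measure_apply {f : ℝ → ℝ} {T : H →L[ℂ] H} (h : P.Represents f T)
    (h2 : P.Represents (fun t => f t * f t) (T * T)) (hf : Measurable f) (hf1 : ∀ t, |f t| ≤ 1)
    (ψ : H) :
    P.measure (T ψ) = (P.measure ψ).withDensity (fun t => ENNReal.ofReal (f t ^ 2)) := by
  refine Measure.ext fun s hs => ?_
  have h1 : ⟪T ψ, P.proj s (T ψ)⟫_ℂ = ⟪ψ, (P.proj s * (T * T)) ψ⟫_ℂ := by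
    rw [h.isRep.inner_left, ← mul_assoc, h.comm hs]
    rfl
  have hint : Integrable (fun t => f t ^ 2) (P.measure ψ) :=
    (integrable_const (1 : ℝ)).mono' (hf.pow_const 2).aestronglyMeasurable
      (Eventually.of_forall fun t => by
        rw [Real.norm_eq_abs, abs_pow]; exact pow_le_one₀ (abs_nonneg _) (hf1 t))
  rw [P.measure_apply _ hs, h1, h2 s hs ψ, Complex.ofReal_re, withDensity_apply _ hs,
    ← ofReal_integral_eq_lintegral_ofReal hint.integrableOn
      (Eventually.of_forall fun t => sq_nonneg _), ← integral_indicator hs]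
  congr 2
  ext t
  by_cases ht : t ∈ s <;> simp [ht, sq]

variable (P) in
/-- Every measurable function with values in `[0, 1]` is represented by an operator, in a way that
is compatible with multiplication. -/
theorem exists_represents_mul {g : ℝ → ℝ} (hg : Measurable g) (hg0 : ∀ t, 0 ≤ g t)
    (hg1 : ∀ t, g t ≤ 1) :
    ∃ R : H →L[ℂ] H, ∀ (f : ℝ → ℝ) (T : H →L[ℂ] H), Measurable f → (∀ t, |f t| ≤ 1) →
      P.Represents f T → P.Represents (fun t => g t * f t) (R * T) := by
  let G : ℕ → SimpleFunc ℝ ℝ := SimpleFunc.approxOn g hg (Set.Icc 0 1) 0 (by simp)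
  have hG : ∀ n t, G n t ∈ Set.Icc (0 : ℝ) 1 := fun n t => SimpleFunc.approxOn_mem hg _ n t
  have hGlim : ∀ t, Tendsto (fun n => G n t) atTop (𝓝 (g t)) := fun t =>
    SimpleFunc.tendsto_approxOn hg _ (subset_closure ⟨hg0 t, hg1 t⟩)
  have hGabs : ∀ n t, |G n t| ≤ 1 := fun n t => by
    rw [abs_of_nonneg (hG n t).1]; exact (hG n t).2
  have hind : ∀ s : Set ℝ, ∀ t, |s.indicator (fun _ => (1 : ℝ)) t| ≤ 1 := fun s t => by
    by_cases ht : t ∈ s <;> simp [ht]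
  -- For simple functions the operator is an explicit combination of projections; its weak limit is
  -- the required one, chosen independently of `f` and `T`.
  let R : ℕ → H →L[ℂ] H := fun n => ∑ y ∈ (G n).range, y • P.proj (G n ⁻¹' {y})
  have key : ∀ n (f : ℝ → ℝ) (T : H →L[ℂ] H), Measurable f → (∀ t, |f t| ≤ 1) →
      P.Represents f T → P.Represents (fun t => G n t * f t) (R n * T) := by
    intro n f T hf hf1 hT s hs
    have hy : ∀ y : ℝ, MeasurableSet (G n ⁻¹' {y}) := fun y => (G n).measurableSet_fiber y
    have h1 : P.proj s * (R n * T)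
        = ∑ y ∈ (G n).range, y • (P.proj (s ∩ G n ⁻¹' {y}) * T) := by
      simp only [R, Finset.sum_mul, Finset.mul_sum, smul_mul_assoc, mul_smul_comm]
      exact Finset.sum_congr rfl fun y _ => by
        rw [← mul_assoc, P.proj_mul_proj hs (hy y)]
    rw [h1]
    refine (IsRep.sum (fun y _ => (hT _ (hs.inter (hy y))).const_smul y)
      (fun y _ ψ => ?_)).congr fun t => ?_
    · refine Integrable.const_mul ((integrable_const (1 : ℝ)).mono' ?_
        (Eventually.of_forall fun t => ?_)) y
      · exact ((measurable_const.indicator (hs.inter (hy y))).mul hf).aestronglyMeasurable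
      · rw [Real.norm_eq_abs, abs_mul]
        exact mul_le_one₀ (hind _ t) (abs_nonneg _) (hf1 t)
    -- Only the level set through `t` contributes.
    · rw [Finset.sum_eq_single (G n t)]
      · by_cases ht : t ∈ s
        · have ht' : t ∈ s ∩ G n ⁻¹' {G n t} := ⟨ht, rfl⟩
          simp [ht, ht']
        · have ht' : t ∉ s ∩ G n ⁻¹' {G n t} := fun h => ht h.1
          simp [ht, ht']
      · intro y _ hne
        have ht' : t ∉ s ∩ G n ⁻¹' {y} := fun h => hne h.2.symm
        simp [ht']
      · intro h
        exact absurd (SimpleFunc.mem_range_self (G n) t) h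
  have hRrep : ∀ n, P.Represents (G n) (R n) := fun n => by
    simpa using key n (fun _ => 1) 1 measurable_const (by simp) Represents.one
  obtain ⟨S, hS⟩ := IsRep.exists_limit P.measure_univ (fun n => (hRrep n).isRep)
    (fun n => (G n).measurable) (fun n t => (hG n t).1) (fun n t => (hG n t).2) hGlim
  have hSs : ∀ s, MeasurableSet s →
      IsRep P.measure (fun t => s.indicator (fun _ => 1) t * g t) (P.proj s * S) := by
    intro s hs
    refine hS.mul_swap (P.isRep_proj hs) ?_
    refine IsRep.mul_of_tendsto (h := s.indicator fun _ => 1) P.measure_univ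
      (fun n => (hRrep n).isRep) hS (fun n => (G n).measurable)
      hGabs hGlim (measurable_const.indicator hs) (hind s) (fun n => ?_) (fun t => mul_comm _ _)
    exact ((P.isRep_proj hs).mul_swap (hRrep n).isRep (hRrep n s hs)).congr fun t => mul_comm _ _
  refine ⟨S, fun f T hf hf1 hT s hs => ?_⟩
  rw [← mul_assoc]
  refine IsRep.mul_of_tendsto P.measure_univ (fun n => hRrep n s hs) (hSs s hs)
    (fun n => (measurable_const.indicator hs).mul (G n).measurable) (fun n t => ?_)
    (fun t => (hGlim t).const_mul _) hf hf1 (fun n => ?_) (fun t => mul_assoc _ _ _)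
  · rw [abs_mul]
    exact mul_le_one₀ (hind s t) (abs_nonneg _) (hGabs n t)
  · rw [mul_assoc]
    exact (key n f T hf hf1 hT s hs).congr fun t => (mul_assoc _ _ _).symm

end ProjectionValuedMeasure

/-! ### Positive operators with an everywhere defined resolvent -/

section Resolvent

variable {H : Type*} [NormedAddCommGroup H] [InnerProductSpace ℂ H] [CompleteSpace H]

/-- The quadratic form of `A` is nonnegative. -/
def IsPositivePMap (A : H →ₗ.[ℂ] H) : Prop :=
  ∀ x : A.domain, ∃ r : ℝ, 0 ≤ r ∧ ⟪(x : H), A x⟫_ℂ = r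

/-- `B = (1 + A)⁻¹`. -/
structure IsResolvent (A : H →ₗ.[ℂ] H) (B : H →L[ℂ] H) : Prop where
  apply_mem : ∀ ψ, ∃ h : B ψ ∈ A.domain, A ⟨B ψ, h⟩ = ψ - B ψ
  left_inv : ∀ x : A.domain, B (x + A x) = x

/-- The function `t ↦ (1 + |t|)⁻¹`, which gives the resolvent of a positive operator. -/
noncomputable def resolventFun (t : ℝ) : ℝ := (1 + |t|)⁻¹

theorem resolventFun_pos (t : ℝ) : 0 < resolventFun t := by
  unfold resolventFun; positivity

theorem resolventFun_le_one (t : ℝ) : resolventFun t ≤ 1 :=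
  inv_le_one_of_one_le₀ (by linarith [abs_nonneg t])

theorem abs_resolventFun_le_one (t : ℝ) : |resolventFun t| ≤ 1 := by
  rw [abs_of_pos (resolventFun_pos t)]; exact resolventFun_le_one t

theorem continuous_resolventFun : Continuous resolventFun :=
  (continuous_const.add continuous_abs).inv₀ fun t => (by positivity : (0 : ℝ) < 1 + |t|).ne'

theorem measurable_resolventFun : Measurable resolventFun := continuous_resolventFun.measurable

namespace ProjectionValuedMeasure

variable {P : ProjectionValuedMeasure H} {A : H →ₗ.[ℂ] H} {B : H →L[ℂ] H}

theorem IsSpectralMeasureOf.proj_mem (h : P.IsSpectralMeasureOf A) {s : Set ℝ}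
    (hs : MeasurableSet s) {C : ℝ} (hC : ∀ t ∈ s, |t| ≤ C) (ψ : H) :
    P.proj s ψ ∈ A.domain := by
  rw [h.1, P.measure_proj hs]
  refine (integrable_const (C ^ 2)).mono' (by fun_prop)
    ((ae_restrict_iff' hs).2 (Eventually.of_forall fun t ht => ?_))
  rw [Real.norm_eq_abs, abs_pow]
  exact pow_le_pow_left₀ (abs_nonneg _) (hC t ht) 2

/-- Spectral mass on `[-n, 0)` would give a vector in the domain, namely the projection of `ψ`, with
strictly negative quadratic form. -/
theorem IsSpectralMeasureOf.measure_Iio_zero (h : P.IsSpectralMeasureOf A)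
    (hA : IsPositivePMap A) (ψ : H) : P.measure ψ (Set.Iio 0) = 0 := by
  have h1 : ∀ n : ℕ, P.measure ψ (Set.Ico (-(n : ℝ)) 0) = 0 := by
    intro n
    have hs : MeasurableSet (Set.Ico (-(n : ℝ)) 0) := measurableSet_Ico
    have hb : ∀ t ∈ Set.Ico (-(n : ℝ)) 0, |t| ≤ n := fun t ht => by
      rw [abs_of_neg ht.2]; linarith [ht.1]
    have hx := h.proj_mem hs hb ψ
    obtain ⟨r, hr, hr'⟩ := hA ⟨_, hx⟩
    rw [h.2] at hr'
    simp only [P.measure_proj hs] at hr'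
    have hr'' : ∫ t in Set.Ico (-(n : ℝ)) 0, t ∂(P.measure ψ) = r := by exact_mod_cast hr'
    by_contra hne
    have hpos : 0 < ∫ t in Set.Ico (-(n : ℝ)) 0, -t ∂(P.measure ψ) := by
      rw [setIntegral_pos_iff_support_of_nonneg_ae]
      · refine lt_of_lt_of_le (pos_iff_ne_zero.2 hne) (measure_mono fun t ht => ⟨?_, ht⟩)
        simpa using ht.2.ne
      · exact (ae_restrict_iff' hs).2 (Eventually.of_forall fun t ht => by
          simpa using ht.2.le)
      · refine (integrable_const (n : ℝ)).mono' (by fun_prop)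
          ((ae_restrict_iff' hs).2 (Eventually.of_forall fun t ht => ?_))
        rw [Real.norm_eq_abs, abs_neg]
        exact hb t ht
    rw [integral_neg, hr''] at hpos
    linarith
  have h2 : Set.Iio (0 : ℝ) ⊆ ⋃ n : ℕ, Set.Ico (-(n : ℝ)) 0 := fun t ht => by
    obtain ⟨n, hn⟩ := exists_nat_ge (-t)
    exact Set.mem_iUnion.2 ⟨n, by linarith, ht⟩
  exact measure_mono_null h2 (measure_iUnion_null h1)

/-- The resolvent of `A` is the function `(1 + |t|)⁻¹` of `A`, for any projection-valued measure
of `A`. -/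
theorem IsSpectralMeasureOf.represents_resolvent (h : P.IsSpectralMeasureOf A)
    (hA : IsPositivePMap A) (hB : IsResolvent A B) :
    ∀ (f : ℝ → ℝ) (T : H →L[ℂ] H), Measurable f → (∀ t, |f t| ≤ 1) →
      P.Represents f T → P.Represents (fun t => resolventFun t * f t) (B * T) := by
  obtain ⟨R, hR⟩ := P.exists_represents_mul measurable_resolventFun
    (fun t => (resolventFun_pos t).le) resolventFun_le_one
  suffices hRB : R = B by rwa [hRB] at hR
  have hR1 : P.Represents resolventFun R := by
    simpa using hR (fun _ => 1) 1 measurable_const (by simp) Represents.one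
  have hR2 : P.Represents (fun t => resolventFun t * resolventFun t) (R * R) :=
    hR _ _ measurable_resolventFun abs_resolventFun_le_one hR1
  have hmeas : ∀ ψ, P.measure (R ψ)
      = (P.measure ψ).withDensity (fun t => ENNReal.ofReal (resolventFun t ^ 2)) :=
    hR1.measure_apply hR2 measurable_resolventFun abs_resolventFun_le_one
  have hwm : Measurable (fun t => ENNReal.ofReal (resolventFun t ^ 2)) :=
    (measurable_resolventFun.pow_const 2).ennreal_ofReal
  have hdom : ∀ ψ, R ψ ∈ A.domain := fun ψ => by
    rw [h.1, hmeas, integrable_withDensity_iff_integrable_smul' hwm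
      (Eventually.of_forall fun t => ENNReal.ofReal_lt_top)]
    refine (integrable_const (1 : ℝ)).mono' ?_ (Eventually.of_forall fun t => ?_)
    · exact (hwm.ennreal_toReal.smul (measurable_id.pow_const 2)).aestronglyMeasurable
    · rw [ENNReal.toReal_ofReal (sq_nonneg _), smul_eq_mul, ← mul_pow, Real.norm_eq_abs, abs_pow]
      refine pow_le_one₀ (abs_nonneg _) ?_
      rw [abs_mul, abs_of_pos (resolventFun_pos t), resolventFun, inv_mul_le_one₀ (by positivity)]
      linarith
  -- `L = R((1 + A)R - 1)`. The outer `R` makes its quadratic form computable from that of `A`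
  -- alone: with `w = resolventFun` it is the integral of `w² + w²t - w`, which vanishes for `t ≥
  -- 0`.
  let L : H →ₗ[ℂ] H := (R : H →ₗ[ℂ] H) ∘ₗ
    ((R : H →ₗ[ℂ] H) + A.toFun ∘ₗ LinearMap.codRestrict A.domain (R : H →ₗ[ℂ] H) hdom
      - LinearMap.id)
  have hLval : ∀ ψ, L ψ = R (R ψ + A ⟨R ψ, hdom ψ⟩ - ψ) := fun ψ => rfl
  have hL : L = 0 := by
    rw [← inner_map_self_eq_zero]
    intro ψ
    rw [← inner_conj_symm, hLval, ← hR1.isRep.inner_left, inner_sub_right, inner_add_right]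
    have e1 : ⟪R ψ, R ψ⟫_ℂ = ((∫ t, resolventFun t * resolventFun t ∂(P.measure ψ) : ℝ) : ℂ) := by
      rw [hR1.isRep.inner_left]
      exact hR2.isRep ψ
    have e2 : ⟪R ψ, A ⟨R ψ, hdom ψ⟩⟫_ℂ
        = ((∫ t, resolventFun t ^ 2 * t ∂(P.measure ψ) : ℝ) : ℂ) := by
      rw [h.2 ⟨R ψ, hdom ψ⟩]
      simp only [hmeas]
      rw [integral_withDensity_eq_integral_toReal_smul hwm
        (Eventually.of_forall fun t => ENNReal.ofReal_lt_top)]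
      congr 2
      ext t
      rw [ENNReal.toReal_ofReal (sq_nonneg _), smul_eq_mul]
    have e3 : ⟪R ψ, ψ⟫_ℂ = ((∫ t, resolventFun t ∂(P.measure ψ) : ℝ) : ℂ) := by
      rw [hR1.isRep.inner_left]
      exact hR1.isRep ψ
    have i1 : Integrable (fun t => resolventFun t * resolventFun t) (P.measure ψ) :=
      (integrable_const (1 : ℝ)).mono'
        (measurable_resolventFun.mul measurable_resolventFun).aestronglyMeasurable
        (Eventually.of_forall fun t => by
          rw [Real.norm_eq_abs, abs_mul]
          exact mul_le_one₀ (abs_resolventFun_le_one t) (abs_nonneg _) (abs_resolventFun_le_one t))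
    have i2 : Integrable (fun t => resolventFun t ^ 2 * t) (P.measure ψ) :=
      (integrable_const (1 : ℝ)).mono'
        ((measurable_resolventFun.pow_const 2).mul measurable_id).aestronglyMeasurable
        (Eventually.of_forall fun t => by
          rw [Real.norm_eq_abs, abs_mul, abs_pow, sq, mul_assoc]
          refine mul_le_one₀ (abs_resolventFun_le_one t) (by positivity) ?_
          rw [abs_of_pos (resolventFun_pos t), resolventFun, inv_mul_le_one₀ (by positivity)]
          linarith)
    rw [e1, e2, e3, ← Complex.ofReal_add, ← integral_add i1 i2, ← Complex.ofReal_sub,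
      integral_congr_ae (g := resolventFun), sub_self]
    · simp
    · have h0 : ∀ᵐ t ∂(P.measure ψ), 0 ≤ t := by
        rw [ae_iff]
        simpa [Set.Iio] using h.measure_Iio_zero hA ψ
      filter_upwards [h0] with t ht
      have : 1 + t ≠ 0 := by positivity
      simp only [resolventFun, abs_of_nonneg ht]
      field_simp
  -- As `w > 0`, `R` is injective and the outer `R` can be cancelled, leaving `(1 + A)R = 1`.
  have hinj : ∀ x, R x = 0 → x = 0 := fun x hx => by
    have h1 := hR1.isRep x
    rw [hx, inner_zero_right] at h1
    have h2 : ∫ t, resolventFun t ∂(P.measure x) = 0 := by exact_mod_cast h1.symm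
    rw [integral_eq_zero_iff_of_nonneg (fun t => (resolventFun_pos t).le)
      ((integrable_const (1 : ℝ)).mono' measurable_resolventFun.aestronglyMeasurable
        (Eventually.of_forall abs_resolventFun_le_one))] at h2
    have h3 : P.measure x Set.univ = 0 := by
      have : P.measure x {t | ¬ resolventFun t = 0} = 0 := h2
      convert this
      ext t
      simp [(resolventFun_pos t).ne']
    rw [P.measure_univ, ENNReal.ofReal_eq_zero] at h3
    have : ‖x‖ ^ 2 = 0 := le_antisymm h3 (sq_nonneg _)
    simpa using this
  ext ψ
  have h1 : R ψ + A ⟨R ψ, hdom ψ⟩ - ψ = 0 := hinj _ (by rw [← hLval, hL]; rfl)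
  have h2 := hB.left_inv ⟨R ψ, hdom ψ⟩
  rw [sub_eq_zero.1 h1] at h2
  exact h2.symm

theorem IsSpectralMeasureOf.represents_resolvent_pow (h : P.IsSpectralMeasureOf A)
    (hA : IsPositivePMap A) (hB : IsResolvent A B) (n : ℕ) :
    P.Represents (fun t => resolventFun t ^ n) (B ^ n) := by
  induction n with
  | zero => simpa using Represents.one
  | succ n ih =>
    have := h.represents_resolvent hA hB _ _ (measurable_resolventFun.pow_const n)
      (fun t => by rw [abs_pow]; exact pow_le_one₀ (abs_nonneg _) (abs_resolventFun_le_one t)) ih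
    simpa only [pow_succ'] using this

end ProjectionValuedMeasure

end Resolvent

/-! ### Determining a measure by the moments of the resolvent function -/

section Moments

open scoped BoundedContinuousFunction NNReal

/-- A finite measure on `[0, ∞)` is determined by the integrals of the powers of `(1 + t)⁻¹`. -/
theorem Measure.ext_of_integral_resolventFun_pow {μ ν : Measure ℝ} [IsFiniteMeasure μ]
    [IsFiniteMeasure ν] (hμ : μ (Set.Iio 0) = 0) (hν : ν (Set.Iio 0) = 0)
    (h : ∀ n : ℕ, ∫ t, resolventFun t ^ n ∂μ = ∫ t, resolventFun t ^ n ∂ν) : μ = ν := by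
  have hback : ∀ {ρ : Measure ℝ}, ρ (Set.Iio 0) = 0 →
      (ρ.map Real.toNNReal).map ((↑) : ℝ≥0 → ℝ) = ρ := fun {ρ} hρ => by
    rw [Measure.map_map NNReal.continuous_coe.measurable measurable_real_toNNReal]
    have h1 : ((↑) : ℝ≥0 → ℝ) ∘ Real.toNNReal =ᵐ[ρ] id := by
      have h0 : ∀ᵐ t ∂ρ, 0 ≤ t := by
        rw [ae_iff]
        simpa [Set.Iio] using hρ
      filter_upwards [h0] with t ht
      simp [ht]
    rw [Measure.map_congr h1, Measure.map_id]
  -- On `ℝ≥0` the function `(1 + t)⁻¹` is injective, so the algebra it generates separates points;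
  -- on `ℝ` the absolute value would spoil this.
  rw [← hback hμ, ← hback hν]
  congr 1
  let g : ℝ≥0 →ᵇ ℝ := BoundedContinuousFunction.ofNormedAddCommGroup
    (fun t => resolventFun (t : ℝ)) (continuous_resolventFun.comp NNReal.continuous_coe) 1
    (fun t => abs_resolventFun_le_one _)
  have hg : ∀ t, g t = resolventFun t := fun t => rfl
  let A : StarSubalgebra ℝ (ℝ≥0 →ᵇ ℝ) :=
    { Algebra.adjoin ℝ {g} with
      star_mem' := fun {f} hf => by
        have : star f = f := by ext t; simp
        rwa [this] }
  have hgA : g ∈ A := Algebra.subset_adjoin rfl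
  refine ext_of_forall_mem_subalgebra_integral_eq_of_polish (𝕜 := ℝ) (A := A) ?_ ?_
  · intro x y hxy
    refine ⟨g, ⟨BoundedContinuousFunction.toContinuousMapStarₐ ℝ g, ⟨g, hgA, rfl⟩, rfl⟩, ?_⟩
    rw [hg, hg]
    intro he
    refine hxy (NNReal.coe_injective ?_)
    simpa [resolventFun, abs_of_nonneg] using he
  · intro f hf
    have hf' : f ∈ Algebra.adjoin ℝ {g} := hf
    rw [Algebra.adjoin_singleton_eq_range_aeval] at hf'
    obtain ⟨p, hp⟩ := hf'
    suffices key : ∫ t, Polynomial.aeval g p t ∂(μ.map Real.toNNReal)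
        = ∫ t, Polynomial.aeval g p t ∂(ν.map Real.toNNReal) by
      rw [← hp]
      exact key
    clear hp hf
    induction p using Polynomial.induction_on' with
    | add p q hp hq =>
      have e : ∀ t, (Polynomial.aeval g (p + q)) t
          = Polynomial.aeval g p t + Polynomial.aeval g q t := fun t => by rw [map_add]; rfl
      simp only [e]
      rw [integral_add (BoundedContinuousFunction.integrable _ _)
        (BoundedContinuousFunction.integrable _ _), integral_add
        (BoundedContinuousFunction.integrable _ _) (BoundedContinuousFunction.integrable _ _)]
      exact congrArg₂ (· + ·) hp hq
    | monomial n c =>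
      have e : ∀ t : ℝ≥0, (Polynomial.aeval g (Polynomial.monomial n c)) t
          = c * resolventFun t ^ n := fun t => by
        rw [Polynomial.aeval_monomial, BoundedContinuousFunction.mul_apply,
          BoundedContinuousFunction.pow_apply]
        rfl
      have e2 : ∀ {ρ : Measure ℝ}, ρ (Set.Iio 0) = 0 →
          ∫ t : ℝ≥0, resolventFun t ^ n ∂(ρ.map Real.toNNReal) = ∫ t, resolventFun t ^ n ∂ρ :=
        fun {ρ} hρ => by
          conv_rhs => rw [← hback hρ]
          exact (integral_map (f := fun t => resolventFun t ^ n)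
            NNReal.continuous_coe.measurable.aemeasurable
            (continuous_resolventFun.pow n).aestronglyMeasurable).symm
      simp only [e]
      rw [integral_const_mul, integral_const_mul, e2 hμ, e2 hν, h]

end Moments

/-! ### The spectral theorem for positive operators with a resolvent -/

section SpectralTheorem

variable {H : Type*} [NormedAddCommGroup H] [InnerProductSpace ℂ H] [CompleteSpace H]
  {K : Type*} [NormedAddCommGroup K] [InnerProductSpace ℂ K] [CompleteSpace K]

/-- An isometry that intertwines the resolvents preserves the spectral measures. -/
theorem ProjectionValuedMeasure.IsSpectralMeasureOf.measure_map {P : ProjectionValuedMeasure H}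
    {Q : ProjectionValuedMeasure K} {A : H →ₗ.[ℂ] H} {B : H →L[ℂ] H} {A' : K →ₗ.[ℂ] K}
    {B' : K →L[ℂ] K} (hP : P.IsSpectralMeasureOf A) (hQ : Q.IsSpectralMeasureOf A')
    (hA : IsPositivePMap A) (hA' : IsPositivePMap A') (hB : IsResolvent A B)
    (hB' : IsResolvent A' B') (u : H →ₗᵢ[ℂ] K) (hu : ∀ x, B' (u x) = u (B x)) (ψ : H) :
    P.measure ψ = Q.measure (u ψ) := by
  refine Measure.ext_of_integral_resolventFun_pow (hP.measure_Iio_zero hA ψ)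
    (hQ.measure_Iio_zero hA' _) fun n => ?_
  have hpow : ∀ n : ℕ, ∀ x, (B' ^ n) (u x) = u ((B ^ n) x) := fun n => by
    induction n with
    | zero => simp
    | succ n ih => intro x; simp [pow_succ, hu, ih]
  have h1 := (hP.represents_resolvent_pow hA hB n).isRep ψ
  have h2 := (hQ.represents_resolvent_pow hA' hB' n).isRep (u ψ)
  rw [hpow, u.inner_map_map, h1] at h2
  exact_mod_cast h2

/-- The push-forward of a projection-valued measure. -/
def ProjectionValuedMeasure.map (P : ProjectionValuedMeasure H) {f : ℝ → ℝ} (hf : Measurable f) :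
    ProjectionValuedMeasure H where
  proj s := P.proj (f ⁻¹' s)
  isStarProjection s hs := P.isStarProjection _ (hf hs)
  proj_empty := P.proj_empty
  proj_univ := P.proj_univ
  proj_inter s t hs ht := P.proj_inter _ _ (hf hs) (hf ht)
  hasSum_proj s hs hd ψ := by
    rw [Set.preimage_iUnion]
    exact P.hasSum_proj (fun n => f ⁻¹' s n) (fun n => hf (hs n))
      (fun i j hij => (hd hij).preimage f) ψ

theorem ProjectionValuedMeasure.measure_map (P : ProjectionValuedMeasure H) {f : ℝ → ℝ}
    (hf : Measurable f) (ψ : H) : (P.map hf).measure ψ = (P.measure ψ).map f := by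
  refine Measure.ext fun s hs => ?_
  rw [measure_apply _ _ hs, Measure.map_apply hf hs, measure_apply _ _ (hf hs)]
  rfl

/-- With `ψ = (1 + A)Bψ`, the number `⟪Bψ, ψ⟫ = ‖Bψ‖² + ⟪Bψ, ABψ⟫` is real. -/
theorem IsResolvent.isSelfAdjoint {A : H →ₗ.[ℂ] H} {B : H →L[ℂ] H} (hA : IsPositivePMap A)
    (hB : IsResolvent A B) : IsSelfAdjoint B := by
  rw [ContinuousLinearMap.isSelfAdjoint_iff']
  refine ContinuousLinearMap.ext_of_inner_self fun ψ => ?_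
  obtain ⟨h, h'⟩ := hB.apply_mem ψ
  obtain ⟨r, -, hr⟩ := hA ⟨_, h⟩
  have h1 : ⟪B ψ, ψ⟫_ℂ = ((‖B ψ‖ ^ 2 + r : ℝ) : ℂ) := by
    have : ψ = B ψ + A ⟨_, h⟩ := by rw [h']; abel
    conv_lhs => rw [this, inner_add_right, ← this]
    rw [show ⟪B ψ, A ⟨B ψ, h⟩⟫_ℂ = r from hr, inner_self_eq_norm_sq_to_K]
    push_cast
    rfl
  rw [ContinuousLinearMap.adjoint_inner_right, h1, ← inner_conj_symm, h1, Complex.conj_ofReal]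

theorem IsResolvent.injective {A : H →ₗ.[ℂ] H} {B : H →L[ℂ] H} (hB : IsResolvent A B) {ψ : H}
    (h0 : B ψ = 0) : ψ = 0 := by
  obtain ⟨h, h'⟩ := hB.apply_mem ψ
  have h1 : (⟨B ψ, h⟩ : A.domain) = 0 := Subtype.ext h0
  rw [h1, h0, sub_zero, LinearPMap.map_zero] at h'
  exact h'.symm

/-- Continuous approximations of `t ↦ t⁻¹`. -/
theorem exists_continuous_tendsto_inv : ∃ g : ℕ → ℝ → ℝ, (∀ n, Continuous (g n)) ∧
    (∀ t, Tendsto (fun n => g n t) atTop (𝓝 t⁻¹)) ∧ (∀ n t, |g n t| ≤ |t⁻¹|) ∧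
    (∀ n t, 0 ≤ t * g n t) ∧ ∀ n t, t * g n t ≤ 1 := by
  have hpos : ∀ n : ℕ, (0 : ℝ) < 1 / ((n : ℝ) + 1) := fun n => by positivity
  have hden0 : ∀ (n : ℕ) (t : ℝ), 0 < t ^ 2 + 1 / ((n : ℝ) + 1) := fun n t => by positivity
  have hmul : ∀ (n : ℕ) (t : ℝ), t * (t / (t ^ 2 + 1 / ((n : ℝ) + 1)))
      = t ^ 2 / (t ^ 2 + 1 / ((n : ℝ) + 1)) := fun n t => by ring
  -- Regularizing the denominator keeps continuity at `0`, where the value `0` agrees with the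
  -- convention `0⁻¹ = 0`.
  refine ⟨fun n t => t / (t ^ 2 + 1 / ((n : ℝ) + 1)), fun n => ?_, fun t => ?_, fun n t => ?_,
    fun n t => ?_, fun n t => ?_⟩
  · exact continuous_id.div (by fun_prop) fun t => (hden0 n t).ne'
  · by_cases ht : t = 0
    · simp [ht]
    · have h1 : Tendsto (fun n : ℕ => t ^ 2 + 1 / ((n : ℝ) + 1)) atTop (𝓝 (t ^ 2 + 0)) :=
        tendsto_one_div_add_atTop_nhds_zero_nat.const_add _
      have h2 := (tendsto_const_nhds (x := t)).div h1 (by simpa using ht)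
      have h3 : t / (t ^ 2 + 0) = t⁻¹ := by field_simp; simp
      rwa [h3] at h2
  · by_cases ht : t = 0
    · simp [ht]
    · rw [abs_inv, abs_div, abs_of_pos (hden0 n t), ← one_div,
        div_le_div_iff₀ (hden0 n t) (abs_pos.2 ht), ← sq, sq_abs]
      linarith [hpos n]
  · rw [hmul]
    exact div_nonneg (sq_nonneg _) (hden0 n t).le
  · rw [hmul, div_le_one (hden0 n t)]
    linarith [hpos n]

theorem integral_sub_sq_le {μ : Measure ℝ} {f g h : ℝ → ℝ}
    (hfg : Integrable (fun t => (f t - g t) ^ 2) μ) (hf : Integrable (fun t => (f t - h t) ^ 2) μ)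
    (hg : Integrable (fun t => (g t - h t) ^ 2) μ) :
    ∫ t, (f t - g t) ^ 2 ∂μ ≤ 2 * ∫ t, (f t - h t) ^ 2 ∂μ + 2 * ∫ t, (g t - h t) ^ 2 ∂μ := by
  rw [← integral_const_mul, ← integral_const_mul, ← integral_add (hf.const_mul 2) (hg.const_mul 2)]
  refine integral_mono hfg ((hf.const_mul 2).add (hg.const_mul 2)) fun t => ?_
  simp only
  nlinarith [sq_nonneg ((f t - h t) + (g t - h t))]

/-- The **spectral theorem** for a positive operator with an everywhere defined resolvent. -/
theorem exists_isSpectralMeasureOf {A : H →ₗ.[ℂ] H} {B : H →L[ℂ] H} (hA : IsPositivePMap A)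
    (hB : IsResolvent A B) : ∃ P : ProjectionValuedMeasure H, P.IsSpectralMeasureOf A := by
  have hBs := hB.isSelfAdjoint hA
  -- `E` is the spectral measure of `B`. Formally `A = B⁻¹ - 1`, so that of `A` will be the image of
  -- `E` under `t ↦ t⁻¹ - 1`.
  obtain ⟨E, hrep, hint⟩ : ∃ E : ProjectionValuedMeasure H,
      (∀ f : ℝ → ℝ, Continuous f → IsRep E.measure f (cfc f B)) ∧
      ∀ (f : ℝ → ℝ) (ψ : H), Continuous f → Integrable f (E.measure ψ) := by
    obtain ⟨μ, hμ, hrep, hint⟩ := exists_measure_isRep_cfc B hBs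
    obtain ⟨E, hE⟩ := exists_projectionValuedMeasure hμ hrep
      (fun f g hf hg => cfc_mul f g B hf.continuousOn hg.continuousOn)
    have : E.measure = μ := funext hE
    exact ⟨E, by rwa [this], by rwa [this]⟩
  have hid : cfc (fun t : ℝ => t) B = B := cfc_id' ℝ B
  have hBrep : IsRep E.measure (fun t => t) B := by
    have := hrep _ continuous_id'; rwa [hid] at this
  have hmul : ∀ f g : ℝ → ℝ, Continuous f → Continuous g →
      cfc (fun t => f t * g t) B = cfc f B * cfc g B := fun f g hf hg =>
    cfc_mul f g B hf.continuousOn hg.continuousOn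
  have hnorm : ∀ f : ℝ → ℝ, Continuous f → ∀ ψ,
      ‖cfc f B ψ‖ ^ 2 = ∫ t, f t ^ 2 ∂(E.measure ψ) := fun f hf ψ => by
    have h1 : ⟪cfc f B ψ, cfc f B ψ⟫_ℂ = ((∫ t, f t * f t ∂(E.measure ψ) : ℝ) : ℂ) := by
      rw [(hrep f hf).inner_left, ← mul_apply_eq_comp, ← hmul f f hf hf]
      exact hrep _ (hf.mul hf) ψ
    rw [← inner_self_eq_norm_sq (𝕜 := ℂ), h1]
    simp [sq]
  have hBB : ∀ ψ, ⟪B ψ, B ψ⟫_ℂ = ((∫ t, t ^ 2 ∂(E.measure ψ) : ℝ) : ℂ) := fun ψ => by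
    rw [inner_self_eq_norm_sq_to_K, ← hnorm _ continuous_id' ψ, hid]
    push_cast
    rfl
  have hwm : Measurable fun t : ℝ => ENNReal.ofReal (t ^ 2) :=
    (measurable_id.pow_const 2).ennreal_ofReal
  have hden : ∀ φ, E.measure (B φ) = (E.measure φ).withDensity fun t => ENNReal.ofReal (t ^ 2) := by
    intro φ
    have hfin : IsFiniteMeasure ((E.measure φ).withDensity fun t => ENNReal.ofReal (t ^ 2)) :=
      isFiniteMeasure_withDensity_ofReal (hint _ φ (continuous_id.pow 2)).2
    refine ext_of_forall_integral_eq_of_IsFiniteMeasure fun f => ?_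
    rw [integral_withDensity_eq_integral_toReal_smul hwm
      (Eventually.of_forall fun t => ENNReal.ofReal_lt_top)]
    have h1 := hrep f f.continuous (B φ)
    have h2 := hrep (fun t => t * (f t * t)) (by fun_prop) φ
    rw [hmul (fun t => t) (fun t => f t * t) (by fun_prop) (by fun_prop),
      hmul f (fun t => t) f.continuous (by fun_prop), hid, mul_apply_eq_comp, mul_apply_eq_comp,
      ← hBrep.inner_left, h1] at h2
    have h3 : ∫ t, f t ∂(E.measure (B φ)) = ∫ t, t * (f t * t) ∂(E.measure φ) := by
      exact_mod_cast h2
    rw [h3]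
    congr 1
    ext t
    rw [ENNReal.toReal_ofReal (sq_nonneg _), smul_eq_mul]
    ring
  -- Injectivity of `B` excludes mass at `0`, the only point where `t⁻¹` is a default value.
  have hzero : ∀ ψ, E.measure ψ {0} = 0 := fun ψ => by
    have hs : MeasurableSet ({0} : Set ℝ) := measurableSet_singleton 0
    have h1 := hBB (E.proj {0} ψ)
    rw [E.measure_proj hs, integral_singleton] at h1
    have h2 : E.proj {0} ψ = 0 := hB.injective (by simpa using h1)
    rw [E.measure_apply _ hs, h2]
    simp
  have hfm : Measurable fun t : ℝ => t⁻¹ - 1 := measurable_inv.sub_const 1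
  refine ⟨E.map hfm, fun ψ => ?_, fun ψ => ?_⟩
  · rw [E.measure_map hfm, integrable_map_measure (by fun_prop) hfm.aemeasurable]
    constructor
    · intro hψ
      have hφ := hB.left_inv ⟨ψ, hψ⟩
      simp only at hφ
      rw [← hφ, hden, integrable_withDensity_iff_integrable_smul' hwm
        (Eventually.of_forall fun t => ENNReal.ofReal_lt_top)]
      refine (hint (fun t => (1 + |t|) ^ 2) _ (by fun_prop)).mono' ?_
        (Eventually.of_forall fun t => ?_)
      · exact (hwm.ennreal_toReal.smul (hfm.pow_const 2)).aestronglyMeasurable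
      · rw [ENNReal.toReal_ofReal (sq_nonneg _)]
        simp only [Function.comp, smul_eq_mul]
        rw [← mul_pow, Real.norm_eq_abs, abs_pow]
        refine pow_le_pow_left₀ (abs_nonneg _) ?_ 2
        by_cases ht : t = 0
        · simp [ht]
        · rw [mul_sub, mul_inv_cancel₀ ht, mul_one]
          calc |1 - t| ≤ |1| + |t| := abs_sub _ _
            _ = 1 + |t| := by simp
    · intro hψ
      have hψ' : Integrable (fun t : ℝ => (t⁻¹ - 1) ^ 2) (E.measure ψ) := hψ
      -- With `x = t⁻¹`: `2(x - 1)² + 2 - x² = (x - 2)² ≥ 0`.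
      have hinv : Integrable (fun t : ℝ => t⁻¹ ^ 2) (E.measure ψ) :=
        ((hψ'.const_mul 2).add (integrable_const 2)).mono' (by fun_prop)
          (Eventually.of_forall fun t => by
            simp only [Pi.add_apply]
            rw [Real.norm_eq_abs, abs_of_nonneg (sq_nonneg _)]
            nlinarith [sq_nonneg (t⁻¹ - 2)])
      -- Square integrability of `t⁻¹` makes `g n (B) ψ` a Cauchy sequence; its limit `φ` satisfies
      -- `Bφ = ψ`, and the range of `B` lies in the domain of `A`.
      obtain ⟨g, hgc, hglim, hgle, htg0, htg1⟩ := exists_continuous_tendsto_inv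
      have hD : Tendsto (fun n => ∫ t, (g n t - t⁻¹) ^ 2 ∂(E.measure ψ)) atTop (𝓝 0) := by
        have h0 : (0 : ℝ) = ∫ t, (0 : ℝ) ∂(E.measure ψ) := by simp
        rw [h0]
        refine tendsto_integral_of_dominated_convergence (fun t => 4 * t⁻¹ ^ 2)
          (fun n => ?_) (hinv.const_mul 4) (fun n => Eventually.of_forall fun t => ?_)
          (Eventually.of_forall fun t => ?_)
        · exact (((hgc n).measurable.sub measurable_inv).pow_const 2).aestronglyMeasurable
        · rw [Real.norm_eq_abs, abs_pow, ← sq_abs t⁻¹]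
          have h1 : |g n t - t⁻¹| ≤ 2 * |t⁻¹| := (abs_sub _ _).trans (by linarith [hgle n t])
          calc |g n t - t⁻¹| ^ 2 ≤ (2 * |t⁻¹|) ^ 2 := pow_le_pow_left₀ (abs_nonneg _) h1 2
            _ = 4 * |t⁻¹| ^ 2 := by ring
        · simpa using ((hglim t).sub_const t⁻¹).pow 2
      have hDint : ∀ n, Integrable (fun t => (g n t - t⁻¹) ^ 2) (E.measure ψ) := fun n =>
        (hinv.const_mul 4).mono'
          (((hgc n).measurable.sub measurable_inv).pow_const 2).aestronglyMeasurable
          (Eventually.of_forall fun t => by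
            rw [Real.norm_eq_abs, abs_pow, ← sq_abs t⁻¹]
            have h1 : |g n t - t⁻¹| ≤ 2 * |t⁻¹| := (abs_sub _ _).trans (by linarith [hgle n t])
            calc |g n t - t⁻¹| ^ 2 ≤ (2 * |t⁻¹|) ^ 2 := pow_le_pow_left₀ (abs_nonneg _) h1 2
              _ = 4 * |t⁻¹| ^ 2 := by ring)
      have hcauchy : CauchySeq fun n => cfc (g n) B ψ := by
        rw [Metric.cauchySeq_iff]
        intro ε hε
        obtain ⟨N, hN⟩ := eventually_atTop.1 (hD.eventually_lt_const
          (show (0 : ℝ) < ε ^ 2 / 4 by positivity))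
        refine ⟨N, fun m hm n hn => ?_⟩
        rw [dist_eq_norm]
        have h1 : cfc (g m) B ψ - cfc (g n) B ψ = cfc (fun t => g m t - g n t) B ψ := by
          rw [cfc_sub (g m) (g n) B (hgc m).continuousOn (hgc n).continuousOn]
          simp
        refine lt_of_pow_lt_pow_left₀ 2 hε.le ?_
        rw [h1, hnorm (fun t => g m t - g n t) ((hgc m).sub (hgc n))]
        have h2 := integral_sub_sq_le (hint (fun t => (g m t - g n t) ^ 2) ψ
          (((hgc m).sub (hgc n)).pow 2)) (hDint m) (hDint n)
        linarith [hN m hm, hN n hn]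
      obtain ⟨φ, hφ⟩ := cauchySeq_tendsto_of_complete hcauchy
      have hBφ : Tendsto (fun n => B (cfc (g n) B ψ)) atTop (𝓝 ψ) := by
        rw [tendsto_iff_norm_sub_tendsto_zero]
        have h1 : ∀ n, ‖B (cfc (g n) B ψ) - ψ‖
            = √(∫ t, (t * g n t - 1) ^ 2 ∂(E.measure ψ)) := fun n => by
          rw [← hnorm (fun t => t * g n t - 1) ((continuous_id.mul (hgc n)).sub continuous_const),
            Real.sqrt_sq (norm_nonneg _), cfc_sub (fun t => t * g n t) (fun _ => 1) B
              (continuous_id.mul (hgc n)).continuousOn continuousOn_const,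
            hmul (fun t => t) (g n) continuous_id' (hgc n), hid, cfc_const_one ℝ B]
          rfl
        have h2 : Tendsto (fun n => ∫ t, (t * g n t - 1) ^ 2 ∂(E.measure ψ)) atTop (𝓝 0) := by
          have h0 : (0 : ℝ) = ∫ t, (0 : ℝ) ∂(E.measure ψ) := by simp
          rw [h0]
          refine tendsto_integral_of_dominated_convergence (fun t => 1)
            (fun n => ?_) (integrable_const 1) (fun n => Eventually.of_forall fun t => ?_) ?_
          · exact (((continuous_id.mul (hgc n)).sub continuous_const).pow 2).aestronglyMeasurable
          · have h3 := htg0 n t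
            have h4 := htg1 n t
            rw [Real.norm_eq_abs, abs_pow]
            exact pow_le_one₀ (abs_nonneg _) (abs_le.2 ⟨by linarith, by linarith⟩)
          · have h5 : ∀ᵐ t ∂(E.measure ψ), t ≠ 0 := by
              rw [ae_iff]
              simpa using hzero ψ
            filter_upwards [h5] with t ht
            have h6 := (((hglim t).const_mul t).sub_const 1).pow 2
            simpa [mul_inv_cancel₀ ht] using h6
        simp_rw [h1]
        simpa using h2.sqrt
      rw [tendsto_nhds_unique hBφ ((B.continuous.tendsto φ).comp hφ)]
      exact (hB.apply_mem φ).1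
  -- With `ψ = Bφ` both sides become integrals against the measure of `φ`, and the identity is `t -
  -- t² = t²(t⁻¹ - 1)`.
  · have hφ := hB.left_inv ψ
    set φ := (ψ : H) + A ψ with hφdef
    have hAψ : A ψ = φ - B φ := by rw [hφ, hφdef]; abel
    rw [E.measure_map hfm, integral_map hfm.aemeasurable (by fun_prop), hAψ, ← hφ, hden,
      integral_withDensity_eq_integral_toReal_smul hwm
      (Eventually.of_forall fun t => ENNReal.ofReal_lt_top), inner_sub_right, hBB,
      hBrep.inner_left, hBrep φ, ← Complex.ofReal_sub, ← integral_sub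
        (hint (fun t => t) φ continuous_id') (hint (fun t => t ^ 2) φ (continuous_id'.pow 2))]
    congr 2
    ext t
    rw [ENNReal.toReal_ofReal (sq_nonneg _), smul_eq_mul]
    by_cases ht : t = 0
    · simp [ht]
    · field_simp

end SpectralTheorem

/-! ### The operator `S†S` of a closed antilinear operator -/

section ClosedAntilinear

universe w

variable {H : Type w} [NormedAddCommGroup H] [InnerProductSpace ℂ H] [CompleteSpace H]

theorem antilinearOfRel_apply {r : H → H → Prop} {h0 : r 0 0}
    {hadd : ∀ x y x' y', r x y → r x' y' → r (x + x') (y + y')}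
    {hsmul : ∀ (c : ℂ) x y, r x y → r (c • x) (starRingEnd ℂ c • y)}
    (h : ∀ x y y', r x y → r x y' → y = y') (x : (antilinearOfRel r h0 hadd hsmul).domain) :
    r x (antilinearOfRel r h0 hadd hsmul x) := by
  have : (antilinearOfRel r h0 hadd hsmul x) = x.2.choose := by
    change (antilinearOfRel r h0 hadd hsmul).toFun x = _
    unfold antilinearOfRel
    simp only [dif_pos h]
    rfl
  rw [this]
  exact x.2.choose_spec

variable {S : LinearPMap (starRingEnd ℂ) H H}

theorem antilinearAdjoint_apply (hd : Dense (S.domain : Set H))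
    (x : (antilinearAdjoint S).domain) (z : S.domain) :
    ⟪(x : H), S z⟫_ℂ = ⟪(z : H), antilinearAdjoint S x⟫_ℂ := by
  refine antilinearOfRel_apply ?_ x z
  intro x y y' h h'
  have h1 : ∀ z ∈ S.domain, ⟪y - y', z⟫_ℂ = 0 := fun z hz => by
    rw [← inner_conj_symm, inner_sub_right, ← h ⟨z, hz⟩, ← h' ⟨z, hz⟩, sub_self, map_zero]
  exact sub_eq_zero.1 (hd.eq_zero_of_inner_left ℂ fun z hz => h1 z hz)

/-- The operator `S†S`. -/
noncomputable def adjointMulSelf (S : LinearPMap (starRingEnd ℂ) H H) : H →ₗ.[ℂ] H :=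
  antilinearComp (antilinearAdjoint S) S

theorem adjointMulSelf_spec (hd : Dense (S.domain : Set H)) (x : (adjointMulSelf S).domain) :
    ∃ hx : (x : H) ∈ S.domain, ∀ z : S.domain,
      ⟪S ⟨x, hx⟩, S z⟫_ℂ = ⟪(z : H), adjointMulSelf S x⟫_ℂ :=
  ⟨x.2.choose, fun z => antilinearAdjoint_apply hd ⟨_, x.2.choose_spec⟩ z⟩

/-- Converse to `adjointMulSelf_spec`: from here on `S†S` is handled only through the form identity
`⟪Sx, Sz⟫ = ⟪z, y⟫`, never through the adjoint itself. -/
theorem adjointMulSelf_of_inner (hd : Dense (S.domain : Set H)) (x : S.domain) {y : H}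
    (h : ∀ z : S.domain, ⟪S x, S z⟫_ℂ = ⟪(z : H), y⟫_ℂ) :
    ∃ hx : (x : H) ∈ (adjointMulSelf S).domain, adjointMulSelf S ⟨x, hx⟩ = y := by
  have hx : (x : H) ∈ (adjointMulSelf S).domain := ⟨x.2, y, h⟩
  refine ⟨hx, ?_⟩
  obtain ⟨hx', h'⟩ := adjointMulSelf_spec hd ⟨x, hx⟩
  refine hd.eq_of_inner_right ℂ fun z hz => ?_
  rw [← h' ⟨z, hz⟩, ← h ⟨z, hz⟩]

theorem adjointMulSelf_isPositive (hd : Dense (S.domain : Set H)) :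
    IsPositivePMap (adjointMulSelf S) := fun x => by
  obtain ⟨hx, h⟩ := adjointMulSelf_spec hd x
  refine ⟨‖S ⟨x, hx⟩‖ ^ 2, by positivity, ?_⟩
  rw [← h ⟨x, hx⟩, inner_self_eq_norm_sq_to_K]
  push_cast
  rfl

/-- Von Neumann's device: `b` is the first component of the orthogonal projection of `(ψ, 0)` onto
the closed graph of `S`. The graph of an antilinear operator is only a real subspace, so the
projection is taken over `ℝ`. -/
theorem exists_resolvent_vector
    (hc : IsClosed {p : H × H | ∃ hx : p.1 ∈ S.domain, S ⟨p.1, hx⟩ = p.2}) (ψ : H) :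
    ∃ b : S.domain, ∀ z : S.domain, ⟪(z : H), ψ - b⟫_ℂ = ⟪S b, S z⟫_ℂ := by
  let _ : InnerProductSpace ℝ H := InnerProductSpace.complexToReal
  let G : Submodule ℝ (WithLp 2 (H × H)) :=
    { carrier := {p | ∃ hx : p.fst ∈ S.domain, S ⟨p.fst, hx⟩ = p.snd}
      zero_mem' := ⟨S.domain.zero_mem, S.map_zero⟩
      add_mem' := by
        rintro p q ⟨hp, hp'⟩ ⟨hq, hq'⟩
        refine ⟨S.domain.add_mem hp hq, ?_⟩
        have h := S.map_add ⟨_, hp⟩ ⟨_, hq⟩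
        rw [hp', hq'] at h
        exact h
      smul_mem' := by
        rintro c p ⟨hp, hp'⟩
        have hm : c • p.fst ∈ S.domain := by
          rw [← Complex.coe_smul]; exact S.domain.smul_mem _ hp
        refine ⟨hm, ?_⟩
        have h := S.map_smulₛₗ (c : ℂ) ⟨_, hp⟩
        rw [hp', Complex.conj_ofReal] at h
        have e : (⟨c • p.fst, hm⟩ : S.domain) = (c : ℂ) • ⟨p.fst, hp⟩ :=
          Subtype.ext (Complex.coe_smul c p.fst).symm
        change S ⟨c • p.fst, hm⟩ = c • p.snd
        rw [e, h, Complex.coe_smul] }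
  have hGc : IsClosed (G : Set (WithLp 2 (H × H))) :=
    hc.preimage (WithLp.prod_continuous_ofLp 2 H H)
  have : CompleteSpace G := hGc.completeSpace_coe
  let p : WithLp 2 (H × H) := WithLp.toLp 2 (ψ, 0)
  let q := G.starProjection p
  obtain ⟨hb, hb'⟩ : q ∈ G := G.starProjection_apply_mem p
  have horth : ∀ z : S.domain, (⟪(z : H), ψ - q.fst⟫_ℂ).re = (⟪S z, q.snd⟫_ℂ).re := fun z => by
    have h1 : p - q ∈ Gᗮ := G.sub_starProjection_mem_orthogonal p
    have hz : WithLp.toLp 2 ((z : H), S z) ∈ G := ⟨z.2, rfl⟩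
    have h2 := G.inner_right_of_mem_orthogonal hz h1
    rw [WithLp.prod_inner_apply] at h2
    have h3 : (⟪(z : H), ψ - q.fst⟫_ℂ).re + (⟪S z, 0 - q.snd⟫_ℂ).re = 0 := h2
    rw [zero_sub, inner_neg_right, Complex.neg_re] at h3
    linarith
  refine ⟨⟨q.fst, hb⟩, fun z => ?_⟩
  rw [hb']
  -- Real orthogonality gives only real parts; testing against `i z` recovers the imaginary part.
  have hI := horth (Complex.I • z)
  rw [LinearPMap.map_smulₛₗ, Submodule.coe_smul, inner_smul_left, inner_smul_left,
    Complex.conj_I, map_neg, Complex.conj_I, neg_neg] at hI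
  rw [← inner_conj_symm (q.snd)]
  apply Complex.ext
  · rw [Complex.conj_re]; exact horth z
  · rw [Complex.conj_im]
    simp only [Complex.mul_re, Complex.neg_re, Complex.neg_im, Complex.I_re, Complex.I_im] at hI
    linarith

theorem exists_isResolvent_adjointMulSelf (hd : Dense (S.domain : Set H))
    (hc : IsClosed {p : H × H | ∃ hx : p.1 ∈ S.domain, S ⟨p.1, hx⟩ = p.2}) :
    ∃ B : H →L[ℂ] H, IsResolvent (adjointMulSelf S) B := by
  choose b hb using exists_resolvent_vector hc
  -- The difference `d` of two solutions satisfies `‖d‖² + ‖Sd‖² = 0`. Linearity of `b` follows from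
  -- this uniqueness.
  have huniq : ∀ (ψ : H) (c : S.domain), (∀ z : S.domain, ⟪(z : H), ψ - c⟫_ℂ = ⟪S c, S z⟫_ℂ) →
      b ψ = c := by
    intro ψ c hcc
    have h1 := hb ψ (b ψ - c)
    have h2 := hcc (b ψ - c)
    have h3 : ⟪((b ψ - c : S.domain) : H), (c : H) - b ψ⟫_ℂ
        = ⟪S (b ψ - c), S (b ψ - c)⟫_ℂ := by
      have : (c : H) - b ψ = (ψ - b ψ) - (ψ - c) := by abel
      rw [this, inner_sub_right, h1, h2, ← inner_sub_left, ← LinearPMap.map_sub]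
    have h4 : (c : H) - b ψ = -((b ψ - c : S.domain) : H) := by simp
    rw [h4, inner_neg_right] at h3
    have h5 := congrArg Complex.re h3
    have e1 : (⟪((b ψ - c : S.domain) : H), ((b ψ - c : S.domain) : H)⟫_ℂ).re
        = ‖((b ψ - c : S.domain) : H)‖ ^ 2 := inner_self_eq_norm_sq (𝕜 := ℂ) _
    have e2 : (⟪S (b ψ - c), S (b ψ - c)⟫_ℂ).re
        = ‖S (b ψ - c)‖ ^ 2 := inner_self_eq_norm_sq (𝕜 := ℂ) _
    rw [Complex.neg_re, e1, e2] at h5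
    have h6 : ‖((b ψ - c : S.domain) : H)‖ ^ 2 = 0 := by
      nlinarith [sq_nonneg ‖S (b ψ - c)‖, sq_nonneg ‖((b ψ - c : S.domain) : H)‖]
    have h7 : ((b ψ - c : S.domain) : H) = 0 := by simpa using h6
    exact sub_eq_zero.1 (Subtype.ext h7)
  let L : H →ₗ[ℂ] H :=
    { toFun := fun ψ => b ψ
      map_add' := fun ψ φ => by
        rw [huniq (ψ + φ) (b ψ + b φ) fun z => ?_]
        · rfl
        · rw [LinearPMap.map_add, inner_add_left, ← hb, ← hb, ← inner_add_right]
          congr 1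
          rw [Submodule.coe_add]
          abel
      map_smul' := fun c ψ => by
        rw [huniq (c • ψ) (c • b ψ) fun z => ?_]
        · rfl
        · rw [LinearPMap.map_smulₛₗ, inner_smul_left, Complex.conj_conj, ← hb,
            ← inner_smul_right, smul_sub]
          rfl }
  have hbound : ∀ ψ, ‖L ψ‖ ≤ 1 * ‖ψ‖ := fun ψ => by
    have h1 := congrArg Complex.re (hb ψ (b ψ))
    rw [inner_sub_right, Complex.sub_re] at h1
    have e1 : (⟪(b ψ : H), (b ψ : H)⟫_ℂ).re = ‖(b ψ : H)‖ ^ 2 := inner_self_eq_norm_sq (𝕜 := ℂ) _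
    have e2 : (⟪S (b ψ), S (b ψ)⟫_ℂ).re = ‖S (b ψ)‖ ^ 2 := inner_self_eq_norm_sq (𝕜 := ℂ) _
    rw [e1, e2] at h1
    have h2 : (⟪(b ψ : H), ψ⟫_ℂ).re ≤ ‖(b ψ : H)‖ * ‖ψ‖ := re_inner_le_norm (𝕜 := ℂ) _ _
    have h3 : ‖(b ψ : H)‖ * ‖(b ψ : H)‖ ≤ ‖(b ψ : H)‖ * ‖ψ‖ := by
      nlinarith [sq_nonneg ‖S (b ψ)‖]
    rw [one_mul]
    change ‖(b ψ : H)‖ ≤ _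
    by_cases h0 : ‖(b ψ : H)‖ = 0
    · rw [h0]; positivity
    · exact le_of_mul_le_mul_left h3 (lt_of_le_of_ne (norm_nonneg _) (Ne.symm h0))
  refine ⟨L.mkContinuous 1 hbound, fun ψ => ?_, fun x => ?_⟩
  · exact adjointMulSelf_of_inner hd (b ψ) fun z => (hb ψ z).symm
  · obtain ⟨hx, h⟩ := adjointMulSelf_spec hd x
    change (b _ : H) = _
    rw [huniq _ ⟨x, hx⟩ fun z => ?_]
    rw [h z]
    simp

/-- The quadratic form of `S†S` is bounded by `‖S x‖²` on the domain of `S`. -/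
theorem lintegral_le_of_mem_domain (hd : Dense (S.domain : Set H)) {B : H →L[ℂ] H}
    (hB : IsResolvent (adjointMulSelf S) B) {P : ProjectionValuedMeasure H}
    (hP : P.IsSpectralMeasureOf (adjointMulSelf S)) (x : S.domain) :
    ∫⁻ t, ENNReal.ofReal t ∂(P.measure (x : H)) ≤ ENNReal.ofReal (‖S x‖ ^ 2) := by
  have hpos := adjointMulSelf_isPositive hd
  have key : ∀ n : ℕ, ∫⁻ t in Set.Icc (0 : ℝ) n, ENNReal.ofReal t ∂(P.measure (x : H))
      ≤ ENNReal.ofReal (‖S x‖ ^ 2) := by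
    intro n
    set s := Set.Icc (0 : ℝ) n
    have hs : MeasurableSet s := measurableSet_Icc
    have hsb : ∀ t ∈ s, |t| ≤ (n : ℝ) := fun t ht => by rw [abs_of_nonneg ht.1]; exact ht.2
    have hp := hP.proj_mem hs hsb (x : H)
    obtain ⟨hpS, hinner⟩ := adjointMulSelf_spec hd ⟨_, hp⟩
    simp only at hpS hinner
    have hcomm : P.proj s * B = B * P.proj s := by
      have := hP.represents_resolvent_pow hpos hB 1
      rw [pow_one] at this
      exact this.comm hs
    have hidem : P.proj s (P.proj s (x : H)) = P.proj s (x : H) := by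
      rw [← mul_apply_eq_comp, P.proj_mul_proj hs hs, Set.inter_self]
    -- The spectral projection `p` commutes with `B`, so `A p x` stays in the range of `p`. This
    -- yields `‖Spx‖² = ⟪Spx, Sx⟫`, hence `‖Spx‖ ≤ ‖Sx‖`.
    have hfix : P.proj s (adjointMulSelf S ⟨_, hp⟩) = adjointMulSelf S ⟨_, hp⟩ := by
      have h1 := hB.left_inv ⟨_, hp⟩
      simp only at h1
      have h2 : B (P.proj s (P.proj s x + adjointMulSelf S ⟨_, hp⟩)
          - (P.proj s x + adjointMulSelf S ⟨_, hp⟩)) = 0 := by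
        rw [map_sub, ← mul_apply_eq_comp B, ← hcomm, mul_apply_eq_comp, h1, hidem, sub_self]
      have h3 := hB.injective h2
      rw [map_add, hidem] at h3
      exact sub_eq_zero.1 (by simpa using h3)
    have h1 := hinner x
    have h2 := hinner ⟨_, hpS⟩
    simp only at h2
    rw [← hfix, ← P.inner_proj_left hs, ← h2] at h1
    have h3 : ‖S ⟨_, hpS⟩‖ ≤ ‖S x‖ := by
      have h4 := congrArg Complex.re h1
      have e : (⟪S ⟨_, hpS⟩, S ⟨_, hpS⟩⟫_ℂ).re = ‖S ⟨_, hpS⟩‖ ^ 2 :=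
        inner_self_eq_norm_sq (𝕜 := ℂ) _
      have h5 : (⟪S ⟨_, hpS⟩, S x⟫_ℂ).re ≤ ‖S ⟨_, hpS⟩‖ * ‖S x‖ :=
        re_inner_le_norm (𝕜 := ℂ) _ _
      by_cases h0 : ‖S ⟨_, hpS⟩‖ = 0
      · rw [h0]; positivity
      · refine le_of_mul_le_mul_left ?_ (lt_of_le_of_ne (norm_nonneg _) (Ne.symm h0))
        rw [← sq, ← e, ← h4]
        exact h5
    have h4 : ∫ t in s, t ∂(P.measure (x : H)) = ‖S ⟨_, hpS⟩‖ ^ 2 := by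
      have h5 := hP.2 ⟨_, hp⟩
      simp only [P.measure_proj hs] at h5
      rw [← h2, inner_self_eq_norm_sq_to_K] at h5
      have h6 := congrArg Complex.re h5
      rw [Complex.ofReal_re] at h6
      rw [← h6, ← inner_self_eq_norm_sq (𝕜 := ℂ), inner_self_eq_norm_sq_to_K]
      rfl
    have hint : Integrable (fun t => t) ((P.measure (x : H)).restrict s) :=
      (integrable_const (n : ℝ)).mono' (by fun_prop)
        ((ae_restrict_iff' hs).2 (Eventually.of_forall hsb))
    rw [← ofReal_integral_eq_lintegral_ofReal hint
      ((ae_restrict_iff' hs).2 (Eventually.of_forall fun t ht => ht.1)), h4]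
    exact ENNReal.ofReal_le_ofReal (pow_le_pow_left₀ (norm_nonneg _) h3 2)
  have hU : (⋃ n : ℕ, Set.Icc (0 : ℝ) n) = Set.Ici 0 := by
    ext t
    simp only [Set.mem_iUnion, Set.mem_Icc, Set.mem_Ici, exists_and_left, and_iff_left_iff_imp]
    exact fun _ => exists_nat_ge t
  have hdir : Directed (· ⊆ ·) fun n : ℕ => Set.Icc (0 : ℝ) n :=
    (monotone_nat_of_le_succ fun n => Set.Icc_subset_Icc le_rfl (by simp)).directed_le
  have hae : ∀ᵐ t ∂(P.measure (x : H)), t ∈ Set.Ici (0 : ℝ) := by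
    rw [ae_iff]
    simpa [Set.Iio] using hP.measure_Iio_zero hpos (x : H)
  rw [← Measure.restrict_eq_self_of_ae_mem hae, ← hU, setLIntegral_iUnion_of_directed _ hdir]
  exact iSup_le key

end ClosedAntilinear

/-! ### The relative Tomita operator -/

namespace VonNeumannAlgebra

universe w

variable {H : Type w} [NormedAddCommGroup H] [InnerProductSpace ℂ H] [CompleteSpace H]
  {M : VonNeumannAlgebra H} {Ψ Φ : H}

theorem comm_of_mem_commutant {O O' : H →L[ℂ] H} (hO : O ∈ M) (hO' : O' ∈ M.commutant) (x : H) :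
    O (O' x) = O' (O x) :=
  congrArg (fun T : H →L[ℂ] H => T x) (mem_commutant_iff.1 hO' O hO)

theorem inner_star_left (O : H →L[ℂ] H) (x y : H) : ⟪star O x, y⟫_ℂ = ⟪x, O y⟫_ℂ :=
  ContinuousLinearMap.adjoint_inner_left _ _ _

theorem inner_star_right (O : H →L[ℂ] H) (x y : H) : ⟪x, star O y⟫_ℂ = ⟪O x, y⟫_ℂ :=
  ContinuousLinearMap.adjoint_inner_right _ _ _

/-- The projection onto the closure of `M'Ψ` commutes with `M'`, so it lies in `M`; its complement
annihilates `Ψ` and therefore vanishes. -/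
theorem IsSeparatingVector.isCyclicVector_commutant (h : M.IsSeparatingVector Ψ) :
    M.commutant.IsCyclicVector Ψ := by
  let V : Submodule ℂ H :=
    { carrier := {x : H | ∃ O ∈ M.commutant, O Ψ = x}
      zero_mem' := ⟨0, zero_mem _, by simp⟩
      add_mem' := by
        rintro x y ⟨O, hO, rfl⟩ ⟨O', hO', rfl⟩
        exact ⟨O + O', add_mem hO hO', by simp⟩
      smul_mem' := by
        rintro c x ⟨O, hO, rfl⟩
        exact ⟨c • O, M.commutant.toStarSubalgebra.smul_mem hO c, by simp⟩ }
  let K := V.topologicalClosure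
  have : CompleteSpace K := V.isClosed_topologicalClosure.completeSpace_coe
  have hKinv : ∀ y ∈ M.commutant, ∀ x ∈ K, y x ∈ K := fun y hy x hx => by
    refine map_mem_closure (s := V) (t := V) y.continuous hx ?_
    rintro _ ⟨O, hO, rfl⟩
    exact ⟨y * O, mul_mem hy hO, rfl⟩
  have he : IsStarProjection K.starProjection := isStarProjection_starProjection
  have heM : K.starProjection ∈ M := by
    rw [IsStarProjection.mem_iff he]
    intro y hy
    rw [Module.End.mem_invtSubmodule]
    intro x hx
    have hr : K.starProjection.range = K := K.range_starProjection
    rw [Submodule.mem_comap]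
    rw [hr] at hx ⊢
    exact hKinv y hy x hx
  have hΨK : Ψ ∈ K := V.le_topologicalClosure ⟨1, one_mem _, rfl⟩
  have h1 : (1 : H →L[ℂ] H) - K.starProjection = 0 := h _ (sub_mem (one_mem _) heM) (by
    simp [Submodule.starProjection_eq_self_iff.2 hΨK])
  intro x
  have h2 : K.starProjection x = x := by rw [← sub_eq_zero.1 h1]; rfl
  have h3 : x ∈ K := Submodule.starProjection_eq_self_iff.1 h2
  exact h3

theorem IsCyclicVector.isSeparatingVector_commutant (h : M.IsCyclicVector Ψ) :
    M.commutant.IsSeparatingVector Ψ := fun O' hO' h0 => by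
  have h1 : (O' : H → H) = 0 := by
    refine Continuous.ext_on h O'.continuous continuous_zero ?_
    rintro _ ⟨O, hO, rfl⟩
    rw [← comm_of_mem_commutant hO hO', h0, map_zero]
    rfl
  ext x
  exact congrFun h1 x

theorem IsCyclicSeparating.commutant (h : M.IsCyclicSeparating Ψ) :
    M.commutant.IsCyclicSeparating Ψ :=
  ⟨h.2.isCyclicVector_commutant, h.1.isSeparatingVector_commutant⟩

theorem isCyclicSeparating_commutant_iff :
    M.commutant.IsCyclicSeparating Ψ ↔ M.IsCyclicSeparating Ψ :=
  ⟨fun h => by simpa using h.commutant, fun h => h.commutant⟩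

theorem IsTomitaPair.of_mem {O : H →L[ℂ] H} (hO : O ∈ M) : M.IsTomitaPair Ψ Φ (O Ψ) (star O Φ) :=
  ⟨fun _ => O, fun _ => hO, tendsto_const_nhds, tendsto_const_nhds⟩

/-- Closability: `⟪O'†Φ, x⟫ = ⟪y, O'Ψ⟫` for `O' ∈ M'`, and `M'Ψ` is dense, so `x` determines `y`. -/
theorem IsTomitaPair.unique (hΨ : M.IsSeparatingVector Ψ) {x y y' : H}
    (h : M.IsTomitaPair Ψ Φ x y) (h' : M.IsTomitaPair Ψ Φ x y') : y = y' := by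
  have key : ∀ {y : H}, M.IsTomitaPair Ψ Φ x y → ∀ O' ∈ M.commutant,
      ⟪star O' Φ, x⟫_ℂ = ⟪y, O' Ψ⟫_ℂ := by
    rintro y ⟨O, hO, h1, h2⟩ O' hO'
    have l1 : Tendsto (fun n => ⟪star O' Φ, O n Ψ⟫_ℂ) atTop (𝓝 ⟪star O' Φ, x⟫_ℂ) :=
      tendsto_const_nhds.inner h1
    have l2 : Tendsto (fun n => ⟪star (O n) Φ, O' Ψ⟫_ℂ) atTop (𝓝 ⟪y, O' Ψ⟫_ℂ) :=
      h2.inner tendsto_const_nhds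
    refine tendsto_nhds_unique l1 (l2.congr fun n => ?_)
    rw [inner_star_left, inner_star_left, comm_of_mem_commutant (hO n) hO']
  refine sub_eq_zero.1 (hΨ.isCyclicVector_commutant.eq_zero_of_inner_left ℂ ?_)
  rintro _ ⟨O', hO', rfl⟩
  rw [inner_sub_left, ← key h O' hO', ← key h' O' hO', sub_self]

theorem relTomita_apply (hΨ : M.IsSeparatingVector Ψ) (x : (M.relTomita Ψ Φ).domain) :
    M.IsTomitaPair Ψ Φ x (M.relTomita Ψ Φ x) :=
  antilinearOfRel_apply (fun _ _ _ h h' => h.unique hΨ h') x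

theorem relTomita_of_pair (hΨ : M.IsSeparatingVector Ψ) {x y : H} (h : M.IsTomitaPair Ψ Φ x y) :
    ∃ hx : x ∈ (M.relTomita Ψ Φ).domain, M.relTomita Ψ Φ ⟨x, hx⟩ = y :=
  ⟨⟨y, h⟩, (relTomita_apply hΨ ⟨x, ⟨y, h⟩⟩).unique hΨ h⟩

theorem dense_domain_relTomita (hΨ : M.IsCyclicVector Ψ) :
    Dense ((M.relTomita Ψ Φ).domain : Set H) :=
  hΨ.mono (by rintro _ ⟨O, hO, rfl⟩; exact ⟨_, IsTomitaPair.of_mem hO⟩)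

theorem isClosed_graph_relTomita (hΨ : M.IsSeparatingVector Ψ) :
    IsClosed {p : H × H | ∃ hx : p.1 ∈ (M.relTomita Ψ Φ).domain,
      M.relTomita Ψ Φ ⟨p.1, hx⟩ = p.2} := by
  have : {p : H × H | ∃ hx : p.1 ∈ (M.relTomita Ψ Φ).domain, M.relTomita Ψ Φ ⟨p.1, hx⟩ = p.2}
      = closure {p : H × H | ∃ O ∈ M, (O Ψ, star O Φ) = p} := by
    ext ⟨x, y⟩
    rw [mem_closure_iff_seq_limit]
    constructor
    · rintro ⟨hx, hxy⟩
      obtain ⟨O, hO, h1, h2⟩ := relTomita_apply hΨ ⟨x, hx⟩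
      simp only at hxy
      rw [hxy] at h2
      exact ⟨fun n => (O n Ψ, star (O n) Φ), fun n => ⟨O n, hO n, rfl⟩, h1.prodMk_nhds h2⟩
    · rintro ⟨p, hp, hlim⟩
      choose O hO hOp using hp
      obtain rfl : (fun n => (O n Ψ, star (O n) Φ)) = p := funext hOp
      exact relTomita_of_pair hΨ ⟨O, hO, (continuous_fst.tendsto _).comp hlim,
        (continuous_snd.tendsto _).comp hlim⟩
  rw [this]
  exact isClosed_closure

theorem exists_isResolvent_relModular (hΨ : M.IsCyclicSeparating Ψ) (Φ : H) :
    ∃ B : H →L[ℂ] H, IsResolvent (M.relModular Ψ Φ) B :=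
  exists_isResolvent_adjointMulSelf (dense_domain_relTomita hΨ.1) (isClosed_graph_relTomita hΨ.2)

theorem relModular_isPositive (hΨ : M.IsCyclicSeparating Ψ) (Φ : H) :
    IsPositivePMap (M.relModular Ψ Φ) :=
  adjointMulSelf_isPositive (dense_domain_relTomita hΨ.1)

theorem exists_isSpectralMeasureOf_relModular (hΨ : M.IsCyclicSeparating Ψ) (Φ : H) :
    ∃ P : ProjectionValuedMeasure H, P.IsSpectralMeasureOf (M.relModular Ψ Φ) := by
  obtain ⟨B, hB⟩ := exists_isResolvent_relModular hΨ Φ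
  exact exists_isSpectralMeasureOf (relModular_isPositive hΨ Φ) hB

end VonNeumannAlgebra

/-! ### Vanishing of the relative entropy -/

section LogIntegral

theorem elog_of_pos {t : ℝ} (ht : 0 < t) : elog t = (Real.log t : EReal) :=
  ENNReal.log_ofReal_of_pos ht

theorem measurable_elog : Measurable elog :=
  ENNReal.measurable_log.comp ENNReal.measurable_ofReal

/-- This is `log t ≤ t - 1` with the positive and negative parts of the logarithm moved to opposite
sides, so that it makes sense in `[0, ∞]` even at `t = 0`. -/
theorem elog_toENNReal_add_one_le {t : ℝ} (ht : 0 ≤ t) :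
    (elog t).toENNReal + 1 ≤ ENNReal.ofReal t + (-elog t).toENNReal := by
  rcases ht.eq_or_lt with rfl | ht
  · simp [elog]
  · rw [elog_of_pos ht, ← EReal.coe_neg, EReal.toENNReal_of_ne_top (EReal.coe_ne_top _),
      EReal.toENNReal_of_ne_top (EReal.coe_ne_top _), EReal.toReal_coe, EReal.toReal_coe,
      ← ENNReal.ofReal_one]
    have hlog := Real.log_le_sub_one_of_pos ht
    rcases le_total 0 (Real.log t) with h | h
    · rw [← ENNReal.ofReal_add h zero_le_one]
      exact le_add_right (ENNReal.ofReal_le_ofReal (by linarith))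
    · rw [ENNReal.ofReal_of_nonpos h, zero_add, ← ENNReal.ofReal_add ht.le (by linarith)]
      exact ENNReal.ofReal_le_ofReal (by linarith)

theorem eq_one_of_elog_toENNReal_add_one_eq {t : ℝ} (ht : 0 ≤ t)
    (h : (elog t).toENNReal + 1 = ENNReal.ofReal t + (-elog t).toENNReal) : t = 1 := by
  rcases ht.eq_or_lt with rfl | ht
  · simp [elog] at h
  · by_contra hne
    rw [elog_of_pos ht, ← EReal.coe_neg, EReal.toENNReal_of_ne_top (EReal.coe_ne_top _),
      EReal.toENNReal_of_ne_top (EReal.coe_ne_top _), EReal.toReal_coe, EReal.toReal_coe,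
      ← ENNReal.ofReal_one] at h
    have hlog := Real.log_lt_sub_one_of_pos ht hne
    rcases le_total 0 (Real.log t) with h' | h'
    · rw [← ENNReal.ofReal_add h' zero_le_one, ENNReal.ofReal_of_nonpos (by linarith : -Real.log t ≤ 0),
        add_zero, ENNReal.ofReal_eq_ofReal_iff (by linarith) ht.le] at h
      linarith
    · rw [ENNReal.ofReal_of_nonpos h', zero_add, ← ENNReal.ofReal_add ht.le (by linarith),
        ENNReal.ofReal_eq_ofReal_iff (by linarith) (by linarith)] at h
      linarith

theorem logIntegral_eq_zero_of_ae_eq_one {μ : Measure ℝ} (h : ∀ᵐ t ∂μ, t = 1) :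
    logIntegral μ = 0 := by
  have h1 : ∀ᵐ t ∂(μ.restrict (Set.Ici 0)), elog t = 0 := by
    filter_upwards [ae_restrict_of_ae h] with t ht
    rw [ht, elog_of_pos one_pos]
    simp
  have e1 : ∫⁻ t in Set.Ici (0 : ℝ), (elog t).toENNReal ∂μ = 0 := by
    rw [lintegral_congr_ae (g := fun _ => 0)]
    · simp
    · filter_upwards [h1] with t ht
      simp [ht]
  have e2 : ∫⁻ t in Set.Ici (0 : ℝ), (-elog t).toENNReal ∂μ = 0 := by
    rw [lintegral_congr_ae (g := fun _ => 0)]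
    · simp
    · filter_upwards [h1] with t ht
      simp [ht]
  simp [logIntegral, e1, e2]

theorem ENNReal.eq_of_coe_sub_eq_zero {a b : ℝ≥0∞} (ha : a ≠ ∞)
    (h : (a : EReal) - (b : EReal) = 0) : b = a := by
  lift a to NNReal using ha
  have hb : b ≠ ∞ := fun hb => by
    rw [hb] at h
    simp at h
  lift b to NNReal using hb
  have h2 : ((a : ℝ) : EReal) - ((b : ℝ) : EReal) = 0 := h
  rw [← EReal.coe_sub, EReal.coe_eq_zero] at h2
  have h3 : (b : ℝ) = a := by linarith
  exact_mod_cast h3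

/-- The equality case of Jensen's inequality for the logarithm. -/
theorem ae_eq_one_of_logIntegral_eq_zero {μ : Measure ℝ} [IsFiniteMeasure μ]
    (h0 : μ (Set.Iio 0) = 0) (h1 : ∫⁻ t, ENNReal.ofReal t ∂μ ≤ μ Set.univ)
    (h : logIntegral μ = 0) : ∀ᵐ t ∂μ, t = 1 := by
  have hae : ∀ᵐ t ∂μ, t ∈ Set.Ici (0 : ℝ) := by
    rw [ae_iff]
    simpa [Set.Iio] using h0
  rw [logIntegral, Measure.restrict_eq_self_of_ae_mem hae] at h
  set a := ∫⁻ t, (elog t).toENNReal ∂μ with ha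
  set b := ∫⁻ t, (-elog t).toENNReal ∂μ with hb
  have hμ : μ Set.univ ≠ ∞ := measure_ne_top _ _
  have hle : ∀ t : ℝ, 0 ≤ t → (elog t).toENNReal ≤ ENNReal.ofReal t := fun t ht => by
    rcases ht.eq_or_lt with rfl | ht
    · simp [elog]
    · rw [elog_of_pos ht, EReal.toENNReal_of_ne_top (EReal.coe_ne_top _), EReal.toReal_coe]
      exact ENNReal.ofReal_le_ofReal (by linarith [Real.log_le_sub_one_of_pos ht])
  have hafin : a ≠ ∞ := by
    refine ne_top_of_le_ne_top hμ (le_trans (lintegral_mono_ae ?_) h1)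
    filter_upwards [hae] with t ht using hle t ht
  have hab : b = a := ENNReal.eq_of_coe_sub_eq_zero hafin h
  have hm1 : Measurable fun t => (elog t).toENNReal := measurable_elog.ereal_toENNReal
  have hm2 : Measurable fun t => (-elog t).toENNReal := measurable_elog.neg.ereal_toENNReal
  have hfg : (fun t => (elog t).toENNReal + 1) ≤ᵐ[μ]
      fun t => ENNReal.ofReal t + (-elog t).toENNReal := by
    filter_upwards [hae] with t ht using elog_toENNReal_add_one_le ht
  have e1 : ∫⁻ t, ((elog t).toENNReal + 1) ∂μ = a + μ Set.univ := by
    rw [lintegral_add_left hm1, lintegral_one]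
  have e2 : ∫⁻ t, (ENNReal.ofReal t + (-elog t).toENNReal) ∂μ
      = ∫⁻ t, ENNReal.ofReal t ∂μ + b := by
    rw [lintegral_add_left ENNReal.measurable_ofReal]
  -- The pointwise inequality integrates to `a + μ(ℝ) ≤ ∫ t + b`. Since `a = b` and `∫ t ≤ μ(ℝ)`,
  -- equality holds, and finiteness makes it hold almost everywhere.
  have key := ae_eq_of_ae_le_of_lintegral_le hfg (by rw [e1]; exact ENNReal.add_ne_top.2 ⟨hafin, hμ⟩)
    (ENNReal.measurable_ofReal.add hm2).aemeasurable (by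
      rw [e1, e2, hab, add_comm]
      gcongr)
  filter_upwards [key, hae] with t ht ht0
  exact eq_one_of_elog_toENNReal_add_one_eq ht0 ht

end LogIntegral

/-! ### Spectral characterization of the vectors fixed by a positive operator. -/

section FixedVectors

variable {H : Type*} [NormedAddCommGroup H] [InnerProductSpace ℂ H] [CompleteSpace H]
  {A : H →ₗ.[ℂ] H} {B : H →L[ℂ] H} {P : ProjectionValuedMeasure H}

/-- The constant `1 / 2` is the value of `resolventFun` at `t = 1`: the equation `Ax = x` is the
bounded equation `Bx = x / 2`. -/
theorem ProjectionValuedMeasure.IsSpectralMeasureOf.norm_resolvent_sub_sq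
    (hP : P.IsSpectralMeasureOf A) (hA : IsPositivePMap A) (hB : IsResolvent A B) (x : H) :
    ‖B x - (1 / 2 : ℝ) • x‖ ^ 2 = ∫ t, (resolventFun t - 1 / 2) ^ 2 ∂(P.measure x) := by
  have h0 := (hP.represents_resolvent_pow hA hB 0).isRep x
  have h1 := (hP.represents_resolvent_pow hA hB 1).isRep x
  have h2 := (hP.represents_resolvent_pow hA hB 2).isRep x
  have hs := (hP.represents_resolvent_pow hA hB 1).isRep.inner_left
  simp only [pow_one] at h1 hs
  have hint : ∀ n : ℕ, Integrable (fun t => resolventFun t ^ n) (P.measure x) := fun n =>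
    (integrable_const (1 : ℝ)).mono' (measurable_resolventFun.pow_const n).aestronglyMeasurable
      (Eventually.of_forall fun t => by
        rw [Real.norm_eq_abs, abs_pow]
        exact pow_le_one₀ (abs_nonneg _) (abs_resolventFun_le_one t))
  have e : ∀ t, (resolventFun t - 1 / 2) ^ 2
      = resolventFun t ^ 2 - resolventFun t ^ 1 + 1 / 4 * resolventFun t ^ 0 := fun t => by ring
  simp_rw [e]
  have hint21 : Integrable (fun t => resolventFun t ^ 2 - resolventFun t ^ 1) (P.measure x) :=
    (hint 2).sub (hint 1)
  rw [integral_add hint21 ((hint 0).const_mul _), integral_sub (hint 2) (hint 1),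
    integral_const_mul]
  rw [← inner_self_eq_norm_sq (𝕜 := ℂ)]
  have hc : ⟪B x - (1 / 2 : ℝ) • x, B x - (1 / 2 : ℝ) • x⟫_ℂ
      = ⟪x, (B ^ 2) x⟫_ℂ - ⟪x, B x⟫_ℂ + 1 / 4 * ⟪x, (B ^ 0) x⟫_ℂ := by
    rw [← Complex.coe_smul]
    simp only [inner_sub_left, inner_sub_right, inner_smul_left, inner_smul_right, hs,
      Complex.conj_ofReal, pow_two, pow_zero, mul_apply_eq_comp, one_apply_eq_self]
    push_cast
    ring
  rw [hc, h0, h1, h2]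
  have : (((∫ t, resolventFun t ^ 2 ∂(P.measure x) : ℝ) : ℂ)
      - ((∫ t, resolventFun t ∂(P.measure x) : ℝ) : ℂ)
      + 1 / 4 * ((∫ t, resolventFun t ^ 0 ∂(P.measure x) : ℝ) : ℂ))
      = ((∫ t, resolventFun t ^ 2 ∂(P.measure x) - ∫ t, resolventFun t ^ 1 ∂(P.measure x)
        + 1 / 4 * ∫ t, resolventFun t ^ 0 ∂(P.measure x) : ℝ) : ℂ) := by
    simp only [pow_one]
    push_cast
    ring
  rw [this]
  exact Complex.ofReal_re _

/-- `A x = x` if and only if the spectral measure of `x` is concentrated at `1`. -/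
theorem ProjectionValuedMeasure.IsSpectralMeasureOf.ae_eq_one_iff
    (hP : P.IsSpectralMeasureOf A) (hA : IsPositivePMap A) (hB : IsResolvent A B) (x : H) :
    (∀ᵐ t ∂(P.measure x), t = 1) ↔ ∃ hx : x ∈ A.domain, A ⟨x, hx⟩ = x := by
  have hn := hP.norm_resolvent_sub_sq hA hB x
  have h2 : B x - (1 / 2 : ℝ) • x = 0 ↔ ∃ hx : x ∈ A.domain, A ⟨x, hx⟩ = x := by
    constructor
    · intro h
      obtain ⟨hm, h'⟩ := hB.apply_mem ((2 : ℝ) • x)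
      have e : B ((2 : ℝ) • x) = x := by
        rw [← Complex.coe_smul, map_smul, sub_eq_zero.1 h, Complex.coe_smul, smul_smul]
        norm_num
      have hx : x ∈ A.domain := e ▸ hm
      refine ⟨hx, ?_⟩
      have e' : (⟨B ((2 : ℝ) • x), hm⟩ : A.domain) = ⟨x, hx⟩ := Subtype.ext e
      rw [e', e] at h'
      rw [h', two_smul]
      abel
    · rintro ⟨hx, h⟩
      have h' := hB.left_inv ⟨x, hx⟩
      simp only at h'
      rw [h, map_add, ← two_smul ℝ] at h'
      rw [sub_eq_zero]
      conv_rhs => rw [← h', smul_smul]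
      norm_num
  rw [← h2, ← norm_eq_zero, ← sq_eq_zero_iff, hn, integral_eq_zero_iff_of_nonneg
    (fun t => sq_nonneg _)]
  · have h0 : ∀ᵐ t ∂(P.measure x), 0 ≤ t := by
      rw [ae_iff]
      simpa [Set.Iio] using hP.measure_Iio_zero hA x
    constructor
    · intro h
      filter_upwards [h] with t ht
      simp only [ht, resolventFun, Pi.zero_apply]
      norm_num
    · intro h
      filter_upwards [h, h0] with t ht ht0
      have h3 : resolventFun t = 1 / 2 := by
        have : (resolventFun t - 1 / 2) ^ 2 = 0 := ht
        exact sub_eq_zero.1 (pow_eq_zero_iff (two_ne_zero) |>.1 this)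
      rw [resolventFun, abs_of_nonneg ht0] at h3
      have h4 : (1 + t) = 2 := by
        rw [← inv_inj, h3]; norm_num
      linarith
  · refine (integrable_const (4 : ℝ)).mono'
      ((measurable_resolventFun.sub_const _).pow_const 2).aestronglyMeasurable
      (Eventually.of_forall fun t => ?_)
    rw [Real.norm_eq_abs, abs_of_nonneg (sq_nonneg _)]
    nlinarith [resolventFun_pos t, resolventFun_le_one t]

end FixedVectors

/-! ### Relative entropy, states and isometries. -/

namespace VonNeumannAlgebra

universe w

variable {H : Type w} [NormedAddCommGroup H] [InnerProductSpace ℂ H] [CompleteSpace H]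
  {M : VonNeumannAlgebra H} {Ψ Φ : H}

theorem exists_relEntropy_eq (hΨ : M.IsCyclicSeparating Ψ) (Φ : H) :
    ∃ P : ProjectionValuedMeasure H, P.IsSpectralMeasureOf (M.relModular Ψ Φ) ∧
      M.relEntropy Ψ Φ = -logIntegral (P.measure Ψ) := by
  have h := exists_isSpectralMeasureOf_relModular hΨ Φ
  exact ⟨h.choose, h.choose_spec, by rw [relEntropy, logExpectation, dif_pos h]⟩

/-- The relative entropy of two vectors inducing the same state vanishes. -/
theorem relEntropy_eq_zero (hΨ : M.IsCyclicSeparating Ψ)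
    (h : ∀ O ∈ M, ⟪Φ, O Φ⟫_ℂ = ⟪Ψ, O Ψ⟫_ℂ) : M.relEntropy Ψ Φ = 0 := by
  obtain ⟨P, hP, hPe⟩ := exists_relEntropy_eq hΨ Φ
  obtain ⟨B, hB⟩ := exists_isResolvent_relModular hΨ Φ
  obtain ⟨hx, hx'⟩ := relTomita_of_pair (Φ := Φ) hΨ.2 (IsTomitaPair.of_mem (one_mem M))
  simp only [star_one, one_apply_eq_self] at hx hx'
  rw [hPe, logIntegral_eq_zero_of_ae_eq_one, neg_zero]
  -- It suffices that `ΔΨ = Ψ`. As `SΨ = Φ`, the form identity on `z = OΨ` is the equality of the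
  -- two states at `O†`; limits give all `z`.
  rw [hP.ae_eq_one_iff (relModular_isPositive hΨ Φ) hB]
  refine adjointMulSelf_of_inner (dense_domain_relTomita hΨ.1) ⟨Ψ, hx⟩ fun z => ?_
  rw [hx']
  obtain ⟨O, hO, h1, h2⟩ := relTomita_apply hΨ.2 z
  have l1 : Tendsto (fun n => ⟪Φ, star (O n) Φ⟫_ℂ) atTop (𝓝 ⟪Φ, M.relTomita Ψ Φ z⟫_ℂ) :=
    tendsto_const_nhds.inner h2
  have l2 : Tendsto (fun n => ⟪O n Ψ, Ψ⟫_ℂ) atTop (𝓝 ⟪(z : H), Ψ⟫_ℂ) :=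
    h1.inner tendsto_const_nhds
  refine tendsto_nhds_unique l1 (l2.congr fun n => ?_)
  rw [h _ (star_mem (hO n)), inner_star_right]

/-- Two vectors of the same norm with vanishing relative entropy induce the same state. -/
theorem inner_eq_of_relEntropy_eq_zero (hΨ : M.IsCyclicSeparating Ψ) (hn : ‖Φ‖ = ‖Ψ‖)
    (h : M.relEntropy Ψ Φ = 0) {O : H →L[ℂ] H} (hO : O ∈ M) : ⟪Φ, O Φ⟫_ℂ = ⟪Ψ, O Ψ⟫_ℂ := by
  obtain ⟨P, hP, hPe⟩ := exists_relEntropy_eq hΨ Φ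
  obtain ⟨B, hB⟩ := exists_isResolvent_relModular hΨ Φ
  have hpos := relModular_isPositive hΨ Φ
  have hd := dense_domain_relTomita (Φ := Φ) hΨ.1
  obtain ⟨hx, hx'⟩ := relTomita_of_pair (Φ := Φ) hΨ.2 (IsTomitaPair.of_mem (one_mem M))
  simp only [star_one, one_apply_eq_self] at hx hx'
  have h1 : ∀ᵐ t ∂(P.measure Ψ), t = 1 := by
    refine ae_eq_one_of_logIntegral_eq_zero (hP.measure_Iio_zero hpos Ψ) ?_
      (by rw [h] at hPe; exact (EReal.neg_eq_zero_iff.1 hPe.symm))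
    -- Since `SΨ = Φ`, the first moment of the measure is at most `‖Φ‖² = ‖Ψ‖²`, its total mass.
    rw [P.measure_univ, ← hn]
    have := lintegral_le_of_mem_domain hd hB hP ⟨Ψ, hx⟩
    rwa [hx'] at this
  obtain ⟨hm, hfix⟩ := (hP.ae_eq_one_iff hpos hB Ψ).1 h1
  obtain ⟨hx2, hin⟩ := adjointMulSelf_spec hd ⟨Ψ, hm⟩
  -- The form identity for `ΔΨ = Ψ` is tested at `z = O†Ψ`, where `Sz = OΦ`.
  obtain ⟨hz, hz'⟩ := relTomita_of_pair (Φ := Φ) hΨ.2 (IsTomitaPair.of_mem (star_mem hO))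
  have h2 := hin ⟨_, hz⟩
  rw [hz', star_star] at h2
  have hfix' : adjointMulSelf (M.relTomita Ψ Φ) ⟨Ψ, hm⟩ = Ψ := hfix
  rw [hfix'] at h2
  simp only [hx'] at h2
  rw [h2, inner_star_left]

/-- If an isometry intertwines the relative modular operators, then the relative entropies
agree. -/
theorem relEntropy_eq_of_intertwines {K : Type*} [NormedAddCommGroup K] [InnerProductSpace ℂ K]
    [CompleteSpace K] {N : VonNeumannAlgebra K} (u : H →ₗᵢ[ℂ] K) (hΨ : M.IsCyclicSeparating Ψ)
    (huΨ : N.IsCyclicSeparating (u Ψ))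
    (h : ∀ x : (M.relModular Ψ Φ).domain, ∃ hx : u x ∈ (N.relModular (u Ψ) (u Φ)).domain,
      N.relModular (u Ψ) (u Φ) ⟨u x, hx⟩ = u (M.relModular Ψ Φ x)) :
    M.relEntropy Ψ Φ = N.relEntropy (u Ψ) (u Φ) := by
  obtain ⟨P, hP, hPe⟩ := exists_relEntropy_eq hΨ Φ
  obtain ⟨Q, hQ, hQe⟩ := exists_relEntropy_eq huΨ (u Φ)
  obtain ⟨B, hB⟩ := exists_isResolvent_relModular hΨ Φ
  obtain ⟨B', hB'⟩ := exists_isResolvent_relModular huΨ (u Φ)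
  rw [hPe, hQe, hP.measure_map hQ (relModular_isPositive hΨ Φ) (relModular_isPositive huΨ _) hB hB'
    u fun x => ?_]
  -- Intertwining of the resolvents: `(1 + Δ')uBx = u(1 + Δ)Bx = ux`, to which `B'` is applied.
  obtain ⟨hm, hm'⟩ := hB.apply_mem x
  obtain ⟨hx, hx'⟩ := h ⟨_, hm⟩
  have h1 := hB'.left_inv ⟨_, hx⟩
  rw [hx', hm'] at h1
  simpa using h1

end VonNeumannAlgebra

/-! ### Reconstruction -/

namespace VonNeumannAlgebra

variable {H : Type*} [NormedAddCommGroup H] [InnerProductSpace ℂ H] [CompleteSpace H]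
  {K : Type*} [NormedAddCommGroup K] [InnerProductSpace ℂ K] [CompleteSpace K]
  {M : VonNeumannAlgebra H} {N : VonNeumannAlgebra K} {u : H →ₗᵢ[ℂ] K}

/-- A von Neumann algebra is spanned by its unitary elements. -/
theorem induction_unitary {p : (H →L[ℂ] H) → Prop}
    (hp : ∀ U ∈ M, star U * U = 1 → U * star U = 1 → p U) (h0 : p 0)
    (hadd : ∀ S T, p S → p T → p (S + T)) (hsmul : ∀ (c : ℂ) T, p T → p (c • T)) {O : H →L[ℂ] H}
    (hO : O ∈ M) : p O := by
  -- Being a centralizer, `M` is norm closed, hence a C⋆-algebra, and those are spanned by their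
  -- unitaries.
  have hc : IsClosed (M.toStarSubalgebra : Set (H →L[ℂ] H)) := by
    rw [coe_toStarSubalgebra, ← centralizer_centralizer]
    exact Set.isClosed_centralizer _
  have hmem : (⟨O, hO⟩ : M.toStarSubalgebra)
      ∈ Submodule.span ℂ (unitary M.toStarSubalgebra : Set M.toStarSubalgebra) := by
    rw [CStarAlgebra.span_unitary]
    trivial
  have key : ∀ x ∈ Submodule.span ℂ (unitary M.toStarSubalgebra : Set M.toStarSubalgebra),
      p (x : H →L[ℂ] H) := by
    intro x hx
    induction hx using Submodule.span_induction with
    | mem x hx =>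
      have hx' := Unitary.mem_iff.1 hx
      exact hp x x.2 (congrArg Subtype.val hx'.1) (congrArg Subtype.val hx'.2)
    | zero => exact h0
    | add x y _ _ hx hy => exact hadd _ _ hx hy
    | smul c x _ hx => exact hsmul c _ hx
  exact key _ hmem

/-- The compression `u† R u` of an operator along an isometry. -/
noncomputable def compression (u : H →ₗᵢ[ℂ] K) (R : K →L[ℂ] K) : H →L[ℂ] H :=
  ContinuousLinearMap.adjoint u.toContinuousLinearMap ∘L R ∘L u.toContinuousLinearMap

theorem inner_compression (R : K →L[ℂ] K) (x y : H) :
    ⟪x, compression u R y⟫_ℂ = ⟪u x, R (u y)⟫_ℂ := by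
  simp only [compression, ContinuousLinearMap.comp_apply]
  exact ContinuousLinearMap.adjoint_inner_right u.toContinuousLinearMap x (R (u y))

theorem star_compression (R : K →L[ℂ] K) :
    star (compression u R) = compression u (star R) := by
  ext x
  refine ext_inner_left ℂ fun y => ?_
  rw [inner_star_right, ← inner_conj_symm, inner_compression, inner_conj_symm,
    inner_compression, inner_star_right]

/-- Every element of `M` has a reconstruction in `N`. -/
def HasReconstruction (u : H →ₗᵢ[ℂ] K) (M : VonNeumannAlgebra H) (N : VonNeumannAlgebra K) :
    Prop :=
  ∀ O ∈ M, ∃ R ∈ N, ∀ Θ : H, u (O Θ) = R (u Θ) ∧ u ((star O) Θ) = (star R) (u Θ)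

/-- A reconstruction `R'` of `O' ∈ M'` commutes with `R`, so `O'` commutes with the compression,
which thus lies in `M'' = M`. -/
theorem HasReconstruction.compression_mem (h : HasReconstruction u M.commutant N.commutant)
    {R : K →L[ℂ] K} (hR : R ∈ N) : compression u R ∈ M := by
  rw [← commutant_commutant M, mem_commutant_iff]
  intro O' hO'
  obtain ⟨R', hR', hO'R'⟩ := h O' hO'
  ext y
  refine ext_inner_left ℂ fun x => ?_
  change ⟪x, O' (compression u R y)⟫_ℂ = ⟪x, compression u R (O' y)⟫_ℂ
  rw [← inner_star_left, inner_compression, inner_compression, (hO'R' x).2, (hO'R' y).1,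
    inner_star_left, comm_of_mem_commutant hR hR']

/-- Reconstruction implies equality of relative entropies. -/
theorem HasReconstruction.relEntropy_eq (h : HasReconstruction u M N)
    (hc : ∀ R ∈ N, compression u R ∈ M) {Ψ : H} (hΨ : M.IsCyclicSeparating Ψ)
    (huΨ : N.IsCyclicSeparating (u Ψ)) (Φ : H) :
    M.relEntropy Ψ Φ = N.relEntropy (u Ψ) (u Φ) := by
  refine relEntropy_eq_of_intertwines u hΨ huΨ fun x => ?_
  obtain ⟨hx, hin⟩ := adjointMulSelf_spec (dense_domain_relTomita hΨ.1) x
  obtain ⟨hux, hux'⟩ : ∃ hux : u x ∈ (N.relTomita (u Ψ) (u Φ)).domain,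
      N.relTomita (u Ψ) (u Φ) ⟨u x, hux⟩ = u (M.relTomita Ψ Φ ⟨x, hx⟩) := by
    obtain ⟨O, hO, h1, h2⟩ := relTomita_apply hΨ.2 ⟨x, hx⟩
    choose R hR hOR using fun n => h (O n) (hO n)
    refine relTomita_of_pair huΨ.2 ⟨R, hR, ?_, ?_⟩
    · simp_rw [← fun n => (hOR n Ψ).1]
      exact (u.continuous.tendsto _).comp h1
    · simp_rw [← fun n => (hOR n Φ).2]
      exact (u.continuous.tendsto _).comp h2
  refine adjointMulSelf_of_inner (dense_domain_relTomita huΨ.1) ⟨u x, hux⟩ fun z => ?_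
  let v : K →L[ℂ] H := ContinuousLinearMap.adjoint u.toContinuousLinearMap
  have hv : ∀ (a : H) (b : K), ⟪u a, b⟫_ℂ = ⟪a, v b⟫_ℂ := fun a b =>
    (ContinuousLinearMap.adjoint_inner_right u.toContinuousLinearMap a b).symm
  -- Compressing the approximating sequence in `N` shows that `v = u†` also intertwines the Tomita
  -- operators. Then `⟪uSx, S'z⟫ = ⟪Sx, Svz⟫ = ⟪vz, Δx⟫ = ⟪z, uΔx⟫`.
  obtain ⟨hz, hz'⟩ : ∃ hz : v z ∈ (M.relTomita Ψ Φ).domain,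
      M.relTomita Ψ Φ ⟨v z, hz⟩ = v (N.relTomita (u Ψ) (u Φ) z) := by
    obtain ⟨R, hR, h1, h2⟩ := relTomita_apply huΨ.2 z
    refine relTomita_of_pair hΨ.2 ⟨fun n => compression u (R n), fun n => hc _ (hR n), ?_, ?_⟩
    · exact (v.continuous.tendsto _).comp h1
    · simp_rw [star_compression]
      exact (v.continuous.tendsto _).comp h2
  rw [hux', hv, ← hz', hin ⟨v z, hz⟩]
  simp only
  rw [← inner_conj_symm, ← hv, inner_conj_symm]
  rfl

/-- Unitaries of the commutant do not change the state seen by `N`. -/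
theorem inner_apply_unitary_of_relEntropy_eq
    (hdense : Dense {Ψ : H | M.IsCyclicSeparating Ψ})
    (hu : ∀ Ψ : H, M.IsCyclicSeparating Ψ → N.IsCyclicSeparating (u Ψ))
    (hE : ∀ Ψ Φ : H, M.IsCyclicSeparating Ψ → M.relEntropy Ψ Φ = N.relEntropy (u Ψ) (u Φ))
    {U : H →L[ℂ] H} (hU : U ∈ M.commutant) (hUU : star U * U = 1) {R : K →L[ℂ] K} (hR : R ∈ N)
    (Ψ : H) : ⟪u (U Ψ), R (u (U Ψ))⟫_ℂ = ⟪u Ψ, R (u Ψ)⟫_ℂ := by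
  have hiso : ∀ x y, ⟪U x, U y⟫_ℂ = ⟪x, y⟫_ℂ := fun x y => by
    rw [← inner_star_right, ← mul_apply_eq_comp, hUU, one_apply_eq_self]
  suffices h : (fun Ψ => ⟪u (U Ψ), R (u (U Ψ))⟫_ℂ) = fun Ψ => ⟪u Ψ, R (u Ψ)⟫_ℂ from congrFun h Ψ
  -- The entropy argument needs `Ψ` cyclic and separating; density and continuity give all other
  -- vectors.
  refine Continuous.ext_on hdense ?_ ?_ fun Ψ hΨ => ?_
  · exact (u.continuous.comp U.continuous).inner
      (R.continuous.comp (u.continuous.comp U.continuous))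
  · exact u.continuous.inner (R.continuous.comp u.continuous)
  · refine inner_eq_of_relEntropy_eq_zero (hu Ψ hΨ) ?_ ?_ hR
    · rw [u.norm_map, u.norm_map, @norm_eq_sqrt_re_inner ℂ, hiso, ← @norm_eq_sqrt_re_inner ℂ]
    · rw [← hE Ψ (U Ψ) hΨ]
      refine relEntropy_eq_zero hΨ fun O hO => ?_
      rw [comm_of_mem_commutant hO hU, hiso]

/-- For a unitary `U` of `M'`, the operators `U†(u†Ru)U` and `u†Ru` have the same quadratic form.
Hence the compression commutes with all unitaries of `M'`, and so with `M'`. -/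
theorem compression_mem_of_relEntropy_eq
    (hdense : Dense {Ψ : H | M.IsCyclicSeparating Ψ})
    (hu : ∀ Ψ : H, M.IsCyclicSeparating Ψ → N.IsCyclicSeparating (u Ψ))
    (hE : ∀ Ψ Φ : H, M.IsCyclicSeparating Ψ → M.relEntropy Ψ Φ = N.relEntropy (u Ψ) (u Φ))
    {R : K →L[ℂ] K} (hR : R ∈ N) : compression u R ∈ M := by
  rw [← commutant_commutant M, mem_commutant_iff]
  intro O hO
  refine induction_unitary (M := M.commutant)
    (p := fun O => O * compression u R = compression u R * O) ?_ (by simp)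
    (fun S T hS hT => by rw [add_mul, mul_add, hS, hT])
    (fun c T hT => by rw [smul_mul_assoc, mul_smul_comm, hT]) hO
  intro U hU hUU hUU'
  have h1 : star U * (compression u R * U) = compression u R := by
    refine ContinuousLinearMap.ext_of_inner_self fun Ψ => ?_
    rw [mul_apply_eq_comp, mul_apply_eq_comp, inner_star_right, inner_compression,
      inner_compression]
    exact inner_apply_unitary_of_relEntropy_eq hdense hu hE hU hUU hR Ψ
  conv_lhs => rw [← h1, ← mul_assoc, hUU', one_mul]

/-- If the states seen by the commutant of `N` are invariant under a unitary `V` of `M`, then `V`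
has a reconstruction in `N`. -/
theorem exists_reconstruction_of_unitary (hc : ∀ R ∈ N, compression u R ∈ M) {Ψ : H}
    (hΨ : M.IsSeparatingVector Ψ) (huΨ : N.IsSeparatingVector (u Ψ)) {V : H →L[ℂ] H} (hV : V ∈ M)
    (hVV : star V * V = 1) (hVV' : V * star V = 1)
    (hst : ∀ R ∈ N.commutant, ⟪u (V Ψ), R (u (V Ψ))⟫_ℂ = ⟪u Ψ, R (u Ψ)⟫_ℂ) :
    ∃ R ∈ N, ∀ Θ : H, u (V Θ) = R (u Θ) ∧ u ((star V) Θ) = (star R) (u Θ) := by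
  have hiso : ∀ x y, ⟪V x, V y⟫_ℂ = ⟪x, y⟫_ℂ := fun x y => by
    rw [← inner_star_right, ← mul_apply_eq_comp, hVV, one_apply_eq_self]
  let ev : K → (N.commutant.toStarSubalgebra →ₗ[ℂ] K) := fun x =>
    { toFun := fun T => (T : K →L[ℂ] K) x
      map_add' := fun S T => rfl
      map_smul' := fun c T => rfl }
  -- Equality of states at `T†T` says that `T uΨ ↦ T uVΨ` preserves norms; this also makes it well
  -- defined on the dense set `N'uΨ`.
  have hnorm : ∀ T, ‖ev (u (V Ψ)) T‖ = ‖ev (u Ψ) T‖ := fun T => by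
    have h1 := hst (star (T : K →L[ℂ] K) * T) (mul_mem (star_mem T.2) T.2)
    rw [mul_apply_eq_comp, mul_apply_eq_comp, inner_star_right, inner_star_right] at h1
    rw [@norm_eq_sqrt_re_inner ℂ, @norm_eq_sqrt_re_inner ℂ]
    exact congrArg (fun z : ℂ => √z.re) h1
  have hdr : DenseRange (ev (u Ψ)) := by
    refine huΨ.isCyclicVector_commutant.mono ?_
    rintro _ ⟨T, hT, rfl⟩
    exact ⟨⟨T, hT⟩, rfl⟩
  have hle : ∀ T, ‖ev (u (V Ψ)) T‖ ≤ 1 * ‖ev (u Ψ) T‖ := fun T => by rw [hnorm, one_mul]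
  let R : K →L[ℂ] K := (ev (u (V Ψ))).extendOfNorm (ev (u Ψ))
  have hRT : ∀ T, R (ev (u Ψ) T) = ev (u (V Ψ)) T := fun T =>
    LinearMap.extendOfNorm_eq hdr ⟨1, hle⟩ T
  -- `R` intertwines left multiplication by `N'`, so it lies in `N'' = N`.
  have hRN : R ∈ N := by
    rw [← commutant_commutant N, mem_commutant_iff]
    intro Q hQ
    have h1 : (fun x => Q (R x)) = fun x => R (Q x) := by
      refine hdr.equalizer (Q.continuous.comp R.continuous) (R.continuous.comp Q.continuous) ?_
      ext T
      have h2 := hRT (⟨Q * T, mul_mem hQ T.2⟩ : N.commutant.toStarSubalgebra)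
      change Q (R (ev (u Ψ) T)) = _
      rw [hRT]
      exact h2.symm
    ext x
    exact congrFun h1 x
  have hRnorm : ∀ x, ‖R x‖ = ‖x‖ := fun x => by
    have h1 : (fun x => ‖R x‖) = fun x => ‖x‖ := by
      refine hdr.equalizer R.continuous.norm continuous_norm ?_
      ext T
      change ‖R (ev (u Ψ) T)‖ = ‖ev (u Ψ) T‖
      rw [hRT, hnorm]
    exact congrFun h1 x
  have hRR : star R * R = 1 := ContinuousLinearMap.norm_map_iff_adjoint_comp_self R |>.1 hRnorm
  have hRΨ : R (u Ψ) = u (V Ψ) := hRT ⟨1, one_mem _⟩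
  have hcV : compression u R = V := by
    refine sub_eq_zero.1 (hΨ _ (sub_mem (hc R hRN) hV) ?_)
    rw [sub_apply, sub_eq_zero]
    refine ext_inner_left ℂ fun x => ?_
    rw [inner_compression, hRΨ, u.inner_map_map]
  -- Equality case of Cauchy–Schwarz: both vectors have norm `‖Θ‖` and their inner product is
  -- `‖Θ‖²`.
  have hRV : ∀ Θ, u (V Θ) = R (u Θ) := fun Θ => by
    have h1 : ⟪u (V Θ), R (u Θ)⟫_ℂ = ⟪Θ, Θ⟫_ℂ := by
      rw [← inner_compression, hcV, hiso]
    have h2 : ⟪R (u Θ), u (V Θ)⟫_ℂ = ⟪Θ, Θ⟫_ℂ := by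
      rw [← inner_conj_symm, h1, inner_conj_symm]
    have h3 : ⟪R (u Θ), R (u Θ)⟫_ℂ = ⟪Θ, Θ⟫_ℂ := by
      rw [← inner_star_right, ← mul_apply_eq_comp, hRR, one_apply_eq_self, u.inner_map_map]
    rw [← sub_eq_zero, ← inner_self_eq_zero (𝕜 := ℂ), inner_sub_sub_self, h1, h2, h3,
      u.inner_map_map, hiso]
    ring
  refine ⟨R, hRN, fun Θ => ⟨hRV Θ, ?_⟩⟩
  -- `R` is only known to be an isometry, so `R†` is evaluated on `uΘ = R u V†Θ`, using that `V` is
  -- unitary.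
  have h1 : V ((star V) Θ) = Θ := by rw [← mul_apply_eq_comp, hVV', one_apply_eq_self]
  conv_rhs => rw [← h1, hRV, ← mul_apply_eq_comp, hRR, one_apply_eq_self]

/-- Equality of relative entropies for the algebra and its commutant implies reconstruction. -/
theorem hasReconstruction_of_relEntropy_eq
    (hdense : Dense {Ψ : H | M.IsCyclicSeparating Ψ})
    (hu : ∀ Ψ : H, M.IsCyclicSeparating Ψ → N.IsCyclicSeparating (u Ψ))
    (hE : ∀ Ψ Φ : H, M.IsCyclicSeparating Ψ → M.relEntropy Ψ Φ = N.relEntropy (u Ψ) (u Φ))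
    (hE' : ∀ Ψ Φ : H, M.IsCyclicSeparating Ψ →
      M.commutant.relEntropy Ψ Φ = N.commutant.relEntropy (u Ψ) (u Φ)) :
    HasReconstruction u M N := by
  obtain ⟨Ψ, hΨ⟩ := hdense.nonempty
  intro O hO
  refine induction_unitary (M := M) (p := fun O => ∃ R ∈ N, ∀ Θ : H,
    u (O Θ) = R (u Θ) ∧ u ((star O) Θ) = (star R) (u Θ)) ?_ ?_ ?_ ?_ hO
  · intro V hV hVV hVV'
    refine exists_reconstruction_of_unitary
      (fun R hR => compression_mem_of_relEntropy_eq hdense hu hE hR) hΨ.2 (hu Ψ hΨ).2 hV hVV hVV'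
      fun R hR => inner_apply_unitary_of_relEntropy_eq (M := M.commutant) (N := N.commutant)
        ?_ ?_ ?_ ?_ hVV hR Ψ
    · simpa only [isCyclicSeparating_commutant_iff] using hdense
    · simpa only [isCyclicSeparating_commutant_iff] using hu
    · simpa only [isCyclicSeparating_commutant_iff] using hE'
    · rwa [commutant_commutant]
  · exact ⟨0, zero_mem _, fun Θ => by simp⟩
  · rintro S T ⟨R, hR, h⟩ ⟨R', hR', h'⟩
    exact ⟨R + R', add_mem hR hR', fun Θ => by simp [(h Θ).1, (h Θ).2, (h' Θ).1, (h' Θ).2]⟩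
  · rintro c T ⟨R, hR, h⟩
    exact ⟨c • R, N.toStarSubalgebra.smul_mem hR c, fun Θ => by simp [(h Θ).1, (h Θ).2]⟩

/-- A reconstruction is determined by its action on a separating vector. -/
theorem HasReconstruction.reconstructionFormula (h : HasReconstruction u M N)
    (hu : ∀ Ψ : H, M.IsCyclicSeparating Ψ → N.IsCyclicSeparating (u Ψ)) :
    ReconstructionFormula u M N := by
  intro O hO
  obtain ⟨R, hR, hOR⟩ := h O hO
  refine ⟨R, hR, hOR, fun Φ hΦ T => ?_⟩
  have hRform : ∀ P' ∈ N.commutant, R (P' (u Φ)) = P' (u (O Φ)) := fun P' hP' => by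
    rw [comm_of_mem_commutant hR hP', (hOR Φ).1]
  constructor
  · intro hT
    have h1 : (T : K → K) = R := by
      refine Continuous.ext_on (hu Φ hΦ).2.isCyclicVector_commutant T.continuous R.continuous ?_
      rintro _ ⟨P', hP', rfl⟩
      rw [hT P' hP', hRform P' hP']
    exact DFunLike.coe_injective h1
  · rintro rfl
    exact hRform

theorem bulkReconstruction_iff :
    BulkReconstruction u M N ↔
      HasReconstruction u M N ∧ HasReconstruction u M.commutant N.commutant := by
  constructor
  · intro h
    constructor
    · intro O hO
      obtain ⟨R, hR, R', -, hRR⟩ := h O hO 1 (one_mem _)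
      exact ⟨R, hR, fun Θ => ⟨(hRR Θ).1, (hRR Θ).2.2.1⟩⟩
    · intro O' hO'
      obtain ⟨R, -, R', hR', hRR⟩ := h 1 (one_mem _) O' hO'
      exact ⟨R', hR', fun Θ => ⟨(hRR Θ).2.1, (hRR Θ).2.2.2⟩⟩
  · rintro ⟨h, h'⟩ O hO O' hO'
    obtain ⟨R, hR, hOR⟩ := h O hO
    obtain ⟨R', hR', hOR'⟩ := h' O' hO'
    exact ⟨R, hR, R', hR', fun Θ => ⟨(hOR Θ).1, (hOR' Θ).1, (hOR Θ).2, (hOR' Θ).2⟩⟩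

end VonNeumannAlgebra

/-! ### The equivalence, from the symmetry between the algebras and their commutants. -/

open VonNeumannAlgebra in
theorem theorem1 {Hcode : Type*} [NormedAddCommGroup Hcode] [InnerProductSpace ℂ Hcode]
    [CompleteSpace Hcode] {Hphys : Type*} [NormedAddCommGroup Hphys] [InnerProductSpace ℂ Hphys]
    [CompleteSpace Hphys] (u : Hcode →ₗᵢ[ℂ] Hphys)
    (Mcode : VonNeumannAlgebra Hcode) (Mphys : VonNeumannAlgebra Hphys)
    (hdense : Dense {Ψ : Hcode | Mcode.IsCyclicSeparating Ψ})
    (hu : ∀ Ψ : Hcode, Mcode.IsCyclicSeparating Ψ → Mphys.IsCyclicSeparating (u Ψ)) :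
    (BulkReconstruction u Mcode Mphys ↔ RelativeEntropiesAgree u Mcode Mphys) ∧
      (RelativeEntropiesAgree u Mcode Mphys →
        ReconstructionFormula u Mcode Mphys ∧
          ReconstructionFormula u Mcode.commutant Mphys.commutant) := by
  have hdense' : Dense {Ψ : Hcode | Mcode.commutant.IsCyclicSeparating Ψ} := by
    simpa only [isCyclicSeparating_commutant_iff] using hdense
  have hu' : ∀ Ψ : Hcode, Mcode.commutant.IsCyclicSeparating Ψ →
      Mphys.commutant.IsCyclicSeparating (u Ψ) := by
    simpa only [isCyclicSeparating_commutant_iff] using hu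
  have hback : RelativeEntropiesAgree u Mcode Mphys →
      HasReconstruction u Mcode Mphys ∧
        HasReconstruction u Mcode.commutant Mphys.commutant := fun hE => by
    refine ⟨hasReconstruction_of_relEntropy_eq hdense hu (fun Ψ Φ hΨ => (hE Ψ Φ hΨ).1)
      (fun Ψ Φ hΨ => (hE Ψ Φ hΨ).2), hasReconstruction_of_relEntropy_eq hdense' hu'
        (fun Ψ Φ hΨ => (hE Ψ Φ (isCyclicSeparating_commutant_iff.1 hΨ)).2) (fun Ψ Φ hΨ => ?_)⟩
    rw [commutant_commutant, commutant_commutant]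
    exact (hE Ψ Φ (isCyclicSeparating_commutant_iff.1 hΨ)).1
  refine ⟨⟨fun hB Ψ Φ hΨ => ?_, fun hE => bulkReconstruction_iff.2 (hback hE)⟩, fun hE =>
    ⟨(hback hE).1.reconstructionFormula hu, (hback hE).2.reconstructionFormula hu'⟩⟩
  obtain ⟨h1, h2⟩ := bulkReconstruction_iff.1 hB
  have h1' : HasReconstruction u Mcode.commutant.commutant Mphys.commutant.commutant := by
    rwa [commutant_commutant, commutant_commutant]
  exact ⟨h1.relEntropy_eq (fun R hR => h2.compression_mem hR) hΨ (hu Ψ hΨ) Φ,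
    h2.relEntropy_eq (fun R hR => h1'.compression_mem hR) hΨ.commutant (hu Ψ hΨ).commutant Φ⟩
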